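/- Let $T>0$, $c>0$, $\gamma>0$ and $n\in\mathbb{N}_+$. For $\delta,g>0$ let $$f_{GIG}(x;\lambda,\delta,g)=\mathbf 1_{\{x>0\}}\Big(\frac{g}{\delta}\Big)^{\lambda}\frac{1}{2K_\lambda(g\delta)}\,x^{\lambda-1}\exp\!\big(-\tfrac12(\delta^2x^{-1}+g^2x)\big)$$ be the generalized inverse-Gaussian density ($K_\lambda$ is the modified Bessel function of the second kind), and put $q^{(k)}_r(x)=f_{GIG}(x;k-\tfrac12,cr,\gamma)$ for $r>0$ and $k\in\mathbb{N}_0$. For $r>0$ and $j\in\mathbb{N}_0$ let $m^{(j)}_r$ be the $j$-th moment of the inverse-Gaussian law with parameters $\delta=cr$ and $\gamma$, that is, of the density $$\mathbf 1_{\{x>0\}}\frac{cr}{\sqrt{2\pi}}\,x^{-3/2}\exp\!\Big(-\frac{\gamma^2}{2x}\big(x-\tfrac{c}{\gamma}r\big)^2\Big);$$ all these moments are finite. A stable-$1/2$ subordinator with activity parameter $c$ is an increasing Lévy process $\{S_t\}$ such that, for $t>0$, $S_t$ has density $\mathbf 1_{\{x>0\}}\frac{ct}{\sqrt{2\pi}x^{3/2}}\exp(-\frac{c^2t^2}{2x})$.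 Let $\{\xi_{tT}\}_{0\le t\le T}$ be a stable-$1/2$ random bridge with activity parameter $c$ whose terminal value $U_T=\xi_{TT}$ (the ultimate loss) has the GIG$(n-\tfrac12,cT,\gamma)$ law: $\xi_{0T}=0$ almost surely, $\xi_{TT}$ has density $f_{GIG}(\cdot\,;n-\tfrac12,cT,\gamma)$, and for all $0<t_1<\dots<t_k<T$ the conditional law of $(\xi_{t_1T},\dots,\xi_{t_kT})$ given $\xi_{TT}=z$ is, for almost every $z>0$, that of $(S_{t_1},\dots,S_{t_k})$ given $S_T=z$, where $\{S_t\}$ is a stable-$1/2$ subordinator with activity parameter $c$. Let $\mathcal F^\xi_t=\sigma(\xi_{sT}:0\le s\le t)$. Then for $0\le t<T$ we have $\xi_{tT}\ge 0$ almost surely, the polynomial $x\mapsto\sum_{k=0}^{n}\binom{n}{k}m^{(n-k)}_{T-t}x^k$ is positive on $[0,\infty)$, and the following hold. 1. $U_T$ is integrable, and the best estimate $U_{tT}=\mathbb{E}[U_T\mid\mathcal F^\xi_t]=\mathbb{E}[U_T\mid\xi_{tT}]$ is almost surely the rational function of $\xi_{tT}$ $$U_{tT}=\frac{\sum_{k=0}^{n+1}\binom{n+1}{k}m^{(n+1-k)}_{T-t}\,\xi_{tT}^k}{\sum_{k=0}^{n}\binom{n}{k}m^{(n-k)}_{T-t}\,\xi_{tT}^k}.$$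 2. For every $m\in\mathbb{N}_+$, $U_T^m$ is integrable and almost surely $$\mathbb{E}[\xi_{TT}^m\mid\xi_{tT}]=\frac{\sum_{k=0}^{n+m}\binom{n+m}{k}m^{(n+m-k)}_{T-t}\,\xi_{tT}^k}{\sum_{k=0}^{n}\binom{n}{k}m^{(n-k)}_{T-t}\,\xi_{tT}^k}.$$ 3. For every $0<\alpha<\gamma$, with $\bar\gamma=\sqrt{\gamma^2-\alpha^2}$ and $\bar m^{(k)}_r$ the $k$-th moment of the inverse-Gaussian law with parameters $cr$ and $\bar\gamma$, the variable $e^{\frac12\alpha^2\xi_{TT}}$ is integrable and almost surely $$\mathbb{E}\big[e^{\frac12\alpha^2\xi_{TT}}\mid\xi_{tT}\big]=\frac{\sum_{k=0}^{n}\binom{n}{k}\bar m^{(n-k)}_{T-t}\,\xi_{tT}^k}{\sum_{k=0}^{n}\binom{n}{k}m^{(n-k)}_{T-t}\,\xi_{tT}^k}\,\exp\!\big(\tfrac12\alpha^2\xi_{tT}-c(T-t)(\bar\gamma-\gamma)\big).$$ 4. For $0\le s<t<T$, the conditional law of $\xi_{tT}$ given $\xi_{sT}=x$ has, for almost every $x$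 under the law of $\xi_{sT}$, the density $$y\mapsto\sum_{k=0}^n w^{(k)}_{st}(x)\,q^{(n-k)}_{t-s}(y-x),\qquad w^{(k)}_{st}(x)=\frac{\binom{n}{k}m^{(n-k)}_{t-s}\sum_{j=0}^k\binom{k}{j}m^{(k-j)}_{T-t}\,x^{j}}{\sum_{j=0}^n\binom{n}{j}m^{(n-j)}_{T-s}\,x^{j}},$$ and this density, taken at $x=\xi_{sT}$, is also that of the conditional law of $\xi_{tT}$ given $\mathcal F^\xi_s$. For every $x\ge 0$ the weights $w^{(k)}_{st}(x)$ are non-negative and $\sum_{k=0}^n w^{(k)}_{st}(x)=1$. -/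

import Mathlib

open MeasureTheory ProbabilityTheory Filter Topology
open scoped NNReal ENNReal

noncomputable section

/-- The modified Bessel function of the second kind `K_ν(z)`, for real order `ν` and `z > 0`,
through `K_ν(z) = ∫₀^∞ exp(-z cosh u) cosh(ν u) du`. -/
def besselK (ν z : ℝ) : ℝ :=
  ∫ u in Set.Ioi (0 : ℝ), Real.exp (-z * Real.cosh u) * Real.cosh (ν * u)

/-- The density of the generalized inverse-Gaussian law `GIG(lam, δ, γ)`, for `δ > 0`, `γ > 0`. -/
def gigPDF (lam δ γ x : ℝ) : ℝ :=
  if 0 < x then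
    (γ / δ) ^ lam * (1 / (2 * besselK lam (γ * δ))) * x ^ (lam - 1) *
      Real.exp (-(1 / 2) * (δ ^ 2 * x⁻¹ + γ ^ 2 * x))
  else 0

/-- The generalized inverse-Gaussian law `GIG(lam, δ, γ)`, for `δ > 0`, `γ > 0`. -/
def gigMeasure (lam δ γ : ℝ) : Measure ℝ :=
  volume.withDensity fun x => ENNReal.ofReal (gigPDF lam δ γ x)

/-- The density of the inverse-Gaussian law with parameters `δ > 0`, `γ > 0`. -/
def igPDF (δ γ x : ℝ) : ℝ :=
  if 0 < x then
    δ / Real.sqrt (2 * Real.pi) * (1 / x ^ (3 / 2 : ℝ)) *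
      Real.exp (-(γ ^ 2 / (2 * x)) * (x - δ / γ) ^ 2)
  else 0

/-- The `k`-th moment of the inverse-Gaussian law with parameters `δ > 0`, `γ > 0`. -/
def igMoment (δ γ : ℝ) (k : ℕ) : ℝ := ∫ x, x ^ k * igPDF δ γ x

/-- The polynomial `∑_{k ≤ N} C(N,k) m^{(N-k)} x^k`, where `m^{(j)}` is the `j`-th moment of the
inverse-Gaussian law with parameters `δ`, `γ`. -/
def igPoly (δ γ : ℝ) (N : ℕ) (x : ℝ) : ℝ :=
  ∑ k ∈ Finset.range (N + 1), (N.choose k : ℝ) * igMoment δ γ (N - k) * x ^ k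

/-- The density of the Lévy law with parameter `δ > 0`. -/
def levyPDF (δ x : ℝ) : ℝ :=
  if 0 < x then
    δ / (Real.sqrt (2 * Real.pi) * x ^ (3 / 2 : ℝ)) * Real.exp (-(1 / 2) * (δ ^ 2 / x))
  else 0

/-- A (càdlàg) Lévy process. -/
structure IsLevyProcess {Ω : Type*} [MeasurableSpace Ω] (S : ℝ≥0 → Ω → ℝ) (P : Measure Ω) :
    Prop where
  measurable : ∀ t, Measurable (S t)
  start : ∀ᵐ ω ∂P, S 0 ω = 0
  indep : HasIndepIncrements S P
  stationary : ∀ s h, P.map (fun ω => S (s + h) ω - S s ω) = P.map (S h)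
  stoch_cont : ∀ t, TendstoInMeasure P S (𝓝 t) (S t)
  cadlag : ∀ᵐ ω ∂P, ∀ t, ContinuousWithinAt (fun s => S s ω) (Set.Ici t) t ∧
    ∃ l, Tendsto (fun s => S s ω) (𝓝[<] t) (𝓝 l)

/-- A stable-1/2 subordinator with activity parameter `c > 0`: an increasing Lévy process such that
`S_t` has the Lévy law with parameter `c t`, for `t > 0`. -/
structure IsStableHalfSubordinator {Ω : Type*} [MeasurableSpace Ω] (c : ℝ) (S : ℝ≥0 → Ω → ℝ)
    (P : Measure Ω) : Prop extends IsLevyProcess S P where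
  increasing : ∀ᵐ ω ∂P, Monotone fun t => S t ω
  law : ∀ t : ℝ≥0, 0 < t →
    P.map (S t) = volume.withDensity fun x => ENNReal.ofReal (levyPDF (c * t) x)

/-- `(ξ_t)_{0 ≤ t ≤ T}` is a stable-1/2 random bridge with activity parameter `c` and terminal law
`ν`: it starts from `0`, its terminal value has law `ν`, and given `ξ_T = z` its finite-dimensional
laws are those of a stable-1/2 subordinator `S` given `S_T = z`, for `ν`-almost every `z`.
Conditional laws are regular conditional distributions. Those of `S` given `S_T = z` are determined
for Lebesgue-almost every `z > 0`, so the notion is used for laws `ν` that have a density on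
`(0, ∞)`. Values `ξ_t` with `t > T` play no role. -/
structure IsStableHalfRandomBridge {Ω : Type*} [MeasurableSpace Ω] (c : ℝ) (T : ℝ≥0)
    (ν : Measure ℝ) (ξ : ℝ≥0 → Ω → ℝ) (P : Measure Ω) [IsProbabilityMeasure P] : Prop where
  measurable : ∀ t ≤ T, Measurable (ξ t)
  start : ∀ᵐ ω ∂P, ξ 0 ω = 0
  terminal : P.map (ξ T) = ν
  bridge : ∃ (Ω' : Type) (_ : MeasurableSpace Ω') (P' : Measure Ω') (_ : IsProbabilityMeasure P')
    (S : ℝ≥0 → Ω' → ℝ), IsStableHalfSubordinator c S P' ∧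
    ∀ (k : ℕ) (t : Fin k → ℝ≥0), StrictMono t → (∀ i, 0 < t i ∧ t i < T) →
      ∀ x : Fin k → ℝ, ∀ᵐ z ∂ν,
        condDistrib (fun ω i => ξ (t i) ω) (ξ T) P z {y | ∀ i, y i ≤ x i} =
          condDistrib (fun ω i => S (t i) ω) (S T) P' z {y | ∀ i, y i ≤ x i}

/-- The natural filtration at time `t`: the σ-algebra generated by `ξ_s`, `0 ≤ s ≤ t`. -/
abbrev naturalSigma {Ω : Type*} (ξ : ℝ≥0 → Ω → ℝ) (t : ℝ≥0) : MeasurableSpace Ω :=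
  ⨆ s ∈ Set.Iic t, MeasurableSpace.comap (ξ s) inferInstance

/-- The σ-algebra generated by the single variable `ξ_t`. -/
abbrev currentSigma {Ω : Type*} (ξ : ℝ≥0 → Ω → ℝ) (t : ℝ≥0) : MeasurableSpace Ω :=
  MeasurableSpace.comap (ξ t) inferInstance

/-- The weight `w^{(k)}_{st}(x)`: the rational function of `x`
`C(n,k) m^{(n-k)}_{t-s} ∑_{j ≤ k} C(k,j) m^{(k-j)}_{T-t} x^j / ∑_{j ≤ n} C(n,j) m^{(n-j)}_{T-s} x^j`,
where `m^{(j)}_r` is the `j`-th moment of the inverse-Gaussian law with parameters `c r`, `γ`. -/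
def gigWeight (n : ℕ) (c γ T s t : ℝ) (k : ℕ) (x : ℝ) : ℝ :=
  (n.choose k : ℝ) * igMoment (c * (t - s)) γ (n - k) * igPoly (c * (T - t)) γ k x /
    igPoly (c * (T - s)) γ n x

/-- The mixture `∑_{k ≤ n} w^{(k)}_{st}(x) q^{(n-k)}_{t-s}(y - x)`, where `q^{(j)}_r` is the density
of `GIG(j - 1/2, c r, γ)`. -/
def gigMixture (n : ℕ) (c γ T s t x y : ℝ) : ℝ :=
  ∑ k ∈ Finset.range (n + 1),
    gigWeight n c γ T s t k x * gigPDF (((n - k : ℕ) : ℝ) - 1 / 2) (c * (t - s)) γ (y - x)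

end

/-! The bridge is an h-transform of the subordinator. The GIG(n - 1/2, cT, γ) law has density h(z) =
K z^n exp(-γ²z/2) with respect to the law of S_T (`gigMeasure_eq_withDensity`). Since ξ and S have
the same conditional laws given their terminal values, the law of ξ on [0, T] has density h(S_T)
with respect to that of S (`isTerminalTransform_of_condDistrib`).

Let Q_r be the semigroup of S (`levySemigroup`). Independence and stationarity of increments give,
for s ≤ t ≤ T, E[φ(ξ_t) | past up to s] = Q_{t-s}(φ · Q_{T-t} h)(ξ_s) / Q_{T-s} h(ξ_s), which
`IsTerminalTransform.setLIntegral_eq` records in integrated form. Only explicit semigroup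
computations remain.

They rest on exponential tilting: the Lévy density times exp(-g²u/2) is exp(-gδ) times an
inverse-Gaussian density (`levyPDF_mul_exp`). Hence Q_r sends y^N exp(-g²y/2) to exp(-g²x/2 - gcr)
E[(x + Y)^N], with Y inverse-Gaussian, and this expectation is `igPoly`
(`levySemigroup_pow_mul_exp`). Multiplying h by y^m raises N from n to n + m; multiplying it by
exp(a²y/2) replaces γ by √(γ² - a²). This gives the terminal estimates.

For the transition law, the Appell expansion of `igPoly` at y = x + (y - x) splits the h-transformed
density into powers of y - x times an inverse-Gaussian density, that is, into GIG densities
(`gigMixture_eq`). Chapman–Kolmogorov applied to y^N exp(-γ²y/2) makes the weights sum to 1. -/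

/-! ### Generalized inverse-Gaussian and inverse-Gaussian densities and moments -/

/-- The unnormalised density of the generalized inverse-Gaussian law. -/
noncomputable def gigBase (lam δ g x : ℝ) : ℝ :=
  x ^ (lam - 1) * Real.exp (-(1 / 2) * (δ ^ 2 * x⁻¹ + g ^ 2 * x))

lemma measurable_gigBase (lam δ g : ℝ) : Measurable (gigBase lam δ g) := by
  unfold gigBase; fun_prop

lemma gigBase_pos (lam δ g : ℝ) {x : ℝ} (hx : 0 < x) : 0 < gigBase lam δ g x :=
  mul_pos (Real.rpow_pos_of_pos hx _) (Real.exp_pos _)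

lemma exp_neg_le_two_div_sq {y : ℝ} (hy : 0 < y) : Real.exp (-y) ≤ 2 / y ^ 2 := by
  have h := Real.quadratic_le_exp_of_nonneg hy.le
  rw [Real.exp_neg, inv_eq_one_div, div_le_div_iff₀ (Real.exp_pos _) (by positivity)]
  nlinarith

/-- Near 0, exp(-δ²/(2x)) ≤ 8x²/δ⁴ raises the exponent `lam - 1` by two, which leaves a Gamma
integrand when `lam > -2`. The orders k - 1/2 used below lie in this range. -/
lemma integrableOn_gigBase {lam δ g : ℝ} (hlam : -2 < lam) (hδ : 0 < δ) (hg : 0 < g) :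
    IntegrableOn (gigBase lam δ g) (Set.Ioi 0) := by
  have h1 : IntegrableOn (fun x : ℝ => 8 / δ ^ 4 *
      (x ^ (lam + 1) * Real.exp (-(g ^ 2 / 2) * x ^ (1 : ℝ)))) (Set.Ioi 0) :=
    (integrableOn_rpow_mul_exp_neg_mul_rpow (by linarith) one_pos (by positivity)).const_mul _
  refine Integrable.mono' h1 (measurable_gigBase _ _ _).aestronglyMeasurable ?_
  filter_upwards [ae_restrict_mem measurableSet_Ioi] with x hx
  have hx : 0 < x := hx
  rw [Real.norm_of_nonneg (gigBase_pos _ _ _ hx).le, gigBase]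
  have h2 : Real.exp (-(1 / 2) * (δ ^ 2 * x⁻¹ + g ^ 2 * x)) =
      Real.exp (-(δ ^ 2 / (2 * x))) * Real.exp (-(g ^ 2 / 2) * x ^ (1 : ℝ)) := by
    rw [← Real.exp_add, Real.rpow_one]; congr 1; field_simp; ring
  have h3 := exp_neg_le_two_div_sq (y := δ ^ 2 / (2 * x)) (by positivity)
  have h4 : x ^ (lam + 1) = x ^ (lam - 1) * x ^ 2 := by
    rw [← Real.rpow_natCast, ← Real.rpow_add hx]; congr 1; norm_num; ring
  have h5 : 2 / (δ ^ 2 / (2 * x)) ^ 2 = 8 / δ ^ 4 * x ^ 2 := by field_simp; norm_num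
  rw [h5] at h3
  rw [h2, h4]
  calc x ^ (lam - 1) * (Real.exp (-(δ ^ 2 / (2 * x))) * Real.exp (-(g ^ 2 / 2) * x ^ (1 : ℝ)))
      ≤ x ^ (lam - 1) * (8 / δ ^ 4 * x ^ 2 * Real.exp (-(g ^ 2 / 2) * x ^ (1 : ℝ))) := by
        gcongr
    _ = _ := by ring

lemma integral_gigBase_pos {lam δ g : ℝ} (hlam : -2 < lam) (hδ : 0 < δ) (hg : 0 < g) :
    0 < ∫ x in Set.Ioi 0, gigBase lam δ g x := by
  rw [setIntegral_pos_iff_support_of_nonneg_ae _ (integrableOn_gigBase hlam hδ hg)]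
  · have : Set.Ioi 0 ⊆ Function.support (gigBase lam δ g) ∩ Set.Ioi 0 :=
      fun x hx => ⟨(gigBase_pos _ _ _ hx).ne', hx⟩
    exact lt_of_lt_of_le (by simp) (measure_mono this)
  · filter_upwards [ae_restrict_mem measurableSet_Ioi] with x hx using (gigBase_pos _ _ _ hx).le

/-- The normalising constant of the generalized inverse-Gaussian law. -/
lemma integral_gigBase {lam δ g : ℝ} (hlam : -2 < lam) (hδ : 0 < δ) (hg : 0 < g) :
    ∫ x in Set.Ioi 0, gigBase lam δ g x = 2 * (δ / g) ^ lam * besselK lam (g * δ) := by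
  -- The substitution x = (δ/g) e^u symmetrises the exponent: δ²/x + g²x becomes 2gδ cosh u.
  set r := δ / g with hr
  have hr0 : 0 < r := div_pos hδ hg
  let f : ℝ → ℝ := fun u => r * Real.exp u
  have himg : f '' Set.univ = Set.Ioi 0 := by
    ext x
    simp only [Set.image_univ, Set.mem_range, Set.mem_Ioi, f]
    constructor
    · rintro ⟨u, rfl⟩; positivity
    · intro hx
      exact ⟨Real.log (x / r), by rw [Real.exp_log (by positivity)]; field_simp⟩
  have hder : ∀ u ∈ (Set.univ : Set ℝ), HasDerivWithinAt f (f u) Set.univ u := fun u _ =>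
    ((Real.hasDerivAt_exp u).const_mul r).hasDerivWithinAt
  have hinj : Set.InjOn f Set.univ := fun a _ b _ hab =>
    Real.exp_injective (mul_left_cancel₀ hr0.ne' hab)
  let F : ℝ → ℝ := fun u => r ^ lam * (Real.exp (lam * u) * Real.exp (-(g * δ) * Real.cosh u))
  have hF : ∀ u, |f u| • gigBase lam δ g (f u) = F u := by
    intro u
    have hfu : 0 < f u := by positivity
    have e1 : f u * (f u) ^ (lam - 1) = r ^ lam * Real.exp (lam * u) := by
      rw [Real.rpow_sub_one hfu.ne', mul_div_cancel₀ _ hfu.ne', Real.mul_rpow hr0.le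
        (Real.exp_pos _).le, ← Real.exp_mul, mul_comm u]
    have e2 : -(1 / 2) * (δ ^ 2 * (f u)⁻¹ + g ^ 2 * f u) = -(g * δ) * Real.cosh u := by
      simp only [f, mul_inv, ← Real.exp_neg, Real.cosh_eq, hr]
      field_simp
      ring
    rw [abs_of_pos hfu, smul_eq_mul, gigBase, ← mul_assoc, e1, e2, mul_assoc]
  have hint : Integrable F := by
    have := integrableOn_gigBase hlam hδ hg
    rw [← himg, integrableOn_image_iff_integrableOn_abs_deriv_smul MeasurableSet.univ hder hinj,
      integrableOn_univ] at this
    simpa only [hF] using this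
  have hint' : Integrable (fun u => F (-u)) := hint.comp_neg
  rw [← himg, integral_image_eq_integral_abs_deriv_smul MeasurableSet.univ hder hinj,
    setIntegral_univ]
  simp only [hF]
  -- Folding the line onto u > 0 pairs e^{lam u} with e^{-lam u} and produces the 2 cosh(lam u) of
  -- `besselK`.
  rw [← integral_add_compl (s := Set.Ioi 0) measurableSet_Ioi hint, Set.compl_Ioi,
    show (∫ x in Set.Iic 0, F x) = ∫ x in Set.Ioi 0, F (-x) by simp [integral_comp_neg_Ioi 0 F],
    ← integral_add hint.integrableOn hint'.integrableOn, besselK, ← integral_const_mul]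
  congr 1 with u
  simp only [F, Real.cosh_neg, Real.cosh_eq (lam * u)]
  ring_nf

/-- Completing the square, -(g²/(2x))(x - δ/g)² = gδ - (δ²/x + g²x)/2, and x^k x^{-3/2} has the GIG
exponent of order k - 1/2. -/
lemma pow_mul_igPDF {δ g : ℝ} (hg : 0 < g) (k : ℕ) (x : ℝ) :
    x ^ k * igPDF δ g x = (Set.Ioi 0).indicator (fun x =>
      δ / Real.sqrt (2 * Real.pi) * Real.exp (g * δ) * gigBase ((k : ℝ) - 1 / 2) δ g x) x := by
  by_cases hx : 0 < x
  · rw [Set.indicator_of_mem (show x ∈ Set.Ioi 0 from hx), igPDF, if_pos hx, gigBase]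
    have e1 : x ^ ((k : ℝ) - 1 / 2 - 1) = x ^ k * (1 / x ^ (3 / 2 : ℝ)) := by
      rw [← Real.rpow_natCast, one_div (x ^ (3 / 2 : ℝ)), ← Real.rpow_neg hx.le, ← Real.rpow_add hx]
      congr 1; ring
    have e2 : Real.exp (-(g ^ 2 / (2 * x)) * (x - δ / g) ^ 2) =
        Real.exp (g * δ) * Real.exp (-(1 / 2) * (δ ^ 2 * x⁻¹ + g ^ 2 * x)) := by
      rw [← Real.exp_add]; congr 1; field_simp; ring
    rw [e1, e2]; ring
  · rw [Set.indicator_of_notMem (show x ∉ Set.Ioi 0 from hx), igPDF, if_neg hx, mul_zero]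

lemma igPDF_nonneg {δ : ℝ} (hδ : 0 < δ) (g x : ℝ) : 0 ≤ igPDF δ g x := by
  unfold igPDF; split_ifs <;> positivity

lemma levyPDF_nonneg {δ : ℝ} (hδ : 0 < δ) (x : ℝ) : 0 ≤ levyPDF δ x := by
  unfold levyPDF; split_ifs <;> positivity

lemma igPDF_of_nonpos {x : ℝ} (hx : x ≤ 0) (δ g : ℝ) : igPDF δ g x = 0 := by
  rw [igPDF, if_neg hx.not_gt]

lemma measurable_levyPDF (δ : ℝ) : Measurable (levyPDF δ) := by
  unfold levyPDF
  exact Measurable.ite measurableSet_Ioi (by fun_prop) measurable_const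

lemma measurable_gigPDF (lam δ g : ℝ) : Measurable (gigPDF lam δ g) := by
  unfold gigPDF
  exact Measurable.ite measurableSet_Ioi (by fun_prop) measurable_const

lemma integrable_pow_mul_igPDF {δ g : ℝ} (hδ : 0 < δ) (hg : 0 < g) (k : ℕ) :
    Integrable (fun x => x ^ k * igPDF δ g x) := by
  simp_rw [pow_mul_igPDF hg]
  rw [integrable_indicator_iff measurableSet_Ioi]
  have : (0 : ℝ) ≤ k := k.cast_nonneg
  exact (integrableOn_gigBase (by linarith) hδ hg).const_mul _

lemma igMoment_eq {δ g : ℝ} (hg : 0 < g) (k : ℕ) :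
    igMoment δ g k = δ / Real.sqrt (2 * Real.pi) * Real.exp (g * δ) *
      ∫ x in Set.Ioi 0, gigBase ((k : ℝ) - 1 / 2) δ g x := by
  unfold igMoment
  simp_rw [pow_mul_igPDF hg]
  rw [integral_indicator measurableSet_Ioi, integral_const_mul]

lemma igMoment_pos {δ g : ℝ} (hδ : 0 < δ) (hg : 0 < g) (k : ℕ) : 0 < igMoment δ g k := by
  have : (0 : ℝ) ≤ k := k.cast_nonneg
  rw [igMoment_eq hg]
  have := integral_gigBase_pos (lam := (k : ℝ) - 1 / 2) (by linarith) hδ hg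
  positivity

/-- The `GIG(k - 1/2, δ, g)` law is the `k`-th power tilting of the inverse-Gaussian law. -/
lemma gigPDF_eq_pow_mul_igPDF {δ g : ℝ} (hδ : 0 < δ) (hg : 0 < g) (k : ℕ) (x : ℝ) :
    gigPDF ((k : ℝ) - 1 / 2) δ g x = x ^ k * igPDF δ g x / igMoment δ g k := by
  have hk : (-2 : ℝ) < (k : ℝ) - 1 / 2 := by have : (0 : ℝ) ≤ k := k.cast_nonneg; linarith
  rw [pow_mul_igPDF hg, igMoment_eq hg]
  have hI := integral_gigBase_pos hk hδ hg
  by_cases hx : 0 < x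
  · rw [Set.indicator_of_mem (show x ∈ Set.Ioi 0 from hx), gigPDF, if_pos hx]
    have hB := integral_gigBase hk hδ hg
    have hr : 0 < (δ / g) ^ ((k : ℝ) - 1 / 2) := Real.rpow_pos_of_pos (by positivity) _
    have hK : 0 < besselK ((k : ℝ) - 1 / 2) (g * δ) := by
      rw [hB] at hI
      exact pos_of_mul_pos_right hI (by positivity)
    rw [hB, ← inv_div δ g, Real.inv_rpow (by positivity), gigBase]
    field_simp
  · rw [Set.indicator_of_notMem (show x ∉ Set.Ioi 0 from hx), gigPDF, if_neg hx, zero_div]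

/-- The Esscher transform behind every explicit formula below; it is again the completion of the
square. -/
lemma levyPDF_mul_exp {g : ℝ} (hg : 0 < g) (δ x : ℝ) :
    levyPDF δ x * Real.exp (-(g ^ 2 / 2) * x) = Real.exp (-g * δ) * igPDF δ g x := by
  unfold levyPDF igPDF
  split_ifs with hx
  · have : Real.exp (-(1 / 2) * (δ ^ 2 / x)) * Real.exp (-(g ^ 2 / 2) * x) =
        Real.exp (-g * δ) * Real.exp (-(g ^ 2 / (2 * x)) * (x - δ / g) ^ 2) := by
      rw [← Real.exp_add, ← Real.exp_add]; congr 1; field_simp; ring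
    rw [mul_assoc, this]
    have : x ^ (3 / 2 : ℝ) ≠ 0 := (Real.rpow_pos_of_pos hx _).ne'
    field_simp
  · simp

lemma integrable_add_pow_mul_igPDF {δ g : ℝ} (hδ : 0 < δ) (hg : 0 < g) (N : ℕ) (x : ℝ) :
    Integrable (fun u => (x + u) ^ N * igPDF δ g u) := by
  have : (fun u => (x + u) ^ N * igPDF δ g u) = fun u => ∑ k ∈ Finset.range (N + 1),
      (N.choose k : ℝ) * x ^ k * (u ^ (N - k) * igPDF δ g u) := by
    ext u
    rw [add_pow, Finset.sum_mul]
    exact Finset.sum_congr rfl fun k _ => by ring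
  rw [this]
  exact integrable_finsetSum _ fun k _ => (integrable_pow_mul_igPDF hδ hg _).const_mul _

/-- Binomial expansion under the integral. This reading as E[(x + Y)^N], Y inverse-Gaussian, is how
the polynomials arise from the semigroup. -/
lemma igPoly_eq_integral {δ g : ℝ} (hδ : 0 < δ) (hg : 0 < g) (N : ℕ) (x : ℝ) :
    igPoly δ g N x = ∫ u, (x + u) ^ N * igPDF δ g u := by
  have : (fun u => (x + u) ^ N * igPDF δ g u) = fun u => ∑ k ∈ Finset.range (N + 1),
      (N.choose k : ℝ) * x ^ k * (u ^ (N - k) * igPDF δ g u) := by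
    ext u
    rw [add_pow, Finset.sum_mul]
    exact Finset.sum_congr rfl fun k _ => by ring
  rw [this, integral_finsetSum _ fun k _ => (integrable_pow_mul_igPDF hδ hg _).const_mul _,
    igPoly]
  refine Finset.sum_congr rfl fun k _ => ?_
  rw [integral_const_mul, igMoment]; ring

lemma igPoly_pos {δ g : ℝ} (hδ : 0 < δ) (hg : 0 < g) (N : ℕ) {x : ℝ} (hx : 0 ≤ x) :
    0 < igPoly δ g N x := by
  refine Finset.sum_pos' (fun k _ => ?_) ⟨0, by simp, ?_⟩
  · have := igMoment_pos hδ hg (N - k); positivity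
  · simpa using igMoment_pos hδ hg N

lemma measurable_igPoly (δ g : ℝ) (N : ℕ) : Measurable (igPoly δ g N) := by
  unfold igPoly; fun_prop

/-- The polynomials `igPoly δ g N` form an Appell sequence. -/
lemma igPoly_add {δ g : ℝ} (hδ : 0 < δ) (hg : 0 < g) (N : ℕ) (x u : ℝ) :
    igPoly δ g N (x + u) =
      ∑ k ∈ Finset.range (N + 1), (N.choose k : ℝ) * igPoly δ g k x * u ^ (N - k) := by
  have : ∀ v, (x + u + v) ^ N * igPDF δ g v = ∑ k ∈ Finset.range (N + 1),
      (N.choose k : ℝ) * u ^ (N - k) * ((x + v) ^ k * igPDF δ g v) := by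
    intro v
    rw [show x + u + v = (x + v) + u by ring, add_pow, Finset.sum_mul]
    exact Finset.sum_congr rfl fun k _ => by ring
  rw [igPoly_eq_integral hδ hg]
  simp_rw [this]
  rw [integral_finsetSum _ fun k _ => (integrable_add_pow_mul_igPDF hδ hg _ _).const_mul _]
  refine Finset.sum_congr rfl fun k _ => ?_
  rw [integral_const_mul, igPoly_eq_integral hδ hg]; ring

/-! ### Exponential tilting of the Lévy law -/

/-- The Lévy law with parameter `δ`. -/
noncomputable def levyMeasure (δ : ℝ) : Measure ℝ :=
  volume.withDensity fun x => ENNReal.ofReal (levyPDF δ x)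

lemma lintegral_levyMeasure (δ : ℝ) {f : ℝ → ℝ≥0∞} (hf : Measurable f) :
    ∫⁻ x, f x ∂levyMeasure δ = ∫⁻ x, ENNReal.ofReal (levyPDF δ x) * f x :=
  lintegral_withDensity_eq_lintegral_mul _ (measurable_levyPDF δ).ennreal_ofReal hf

lemma lintegral_levyMeasure_ofReal {δ : ℝ} (hδ : 0 < δ) {f : ℝ → ℝ} (hf : Measurable f) :
    ∫⁻ x, ENNReal.ofReal (f x) ∂levyMeasure δ = ∫⁻ x, ENNReal.ofReal (levyPDF δ x * f x) := by
  rw [lintegral_levyMeasure δ hf.ennreal_ofReal]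
  simp_rw [ENNReal.ofReal_mul (levyPDF_nonneg hδ _)]

/-- Exponential tilting of the Lévy law gives the inverse-Gaussian moments. -/
lemma lintegral_levyMeasure_pow_mul_exp {δ g : ℝ} (hδ : 0 < δ) (hg : 0 < g) (N : ℕ) {x : ℝ}
    (hx : 0 ≤ x) :
    ∫⁻ u, ENNReal.ofReal ((x + u) ^ N * Real.exp (-(g ^ 2 / 2) * (x + u))) ∂levyMeasure δ =
      ENNReal.ofReal (Real.exp (-(g ^ 2 / 2) * x - g * δ) * igPoly δ g N x) := by
  rw [lintegral_levyMeasure_ofReal hδ (by fun_prop), igPoly_eq_integral hδ hg,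
    ← integral_const_mul, ofReal_integral_eq_lintegral_ofReal]
  · refine lintegral_congr fun u => congrArg _ ?_
    have := levyPDF_mul_exp hg δ u
    rw [mul_add, Real.exp_add, sub_eq_add_neg, Real.exp_add, ← neg_mul]
    linear_combination ((x + u) ^ N * Real.exp (-(g ^ 2 / 2) * x)) * this
  · exact (integrable_add_pow_mul_igPDF hδ hg N x).const_mul _
  · refine Eventually.of_forall fun u => ?_
    have := igPDF_nonneg hδ g u
    rcases le_or_gt u 0 with hu | hu
    · simp [igPDF_of_nonpos hu]
    · simp only [Pi.zero_apply]; positivity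

/-- The same identity with `igPoly δ' g N` in place of the power. -/
lemma lintegral_levyMeasure_igPoly_mul_exp {δ δ' g : ℝ} (hδ : 0 < δ) (hδ' : 0 < δ') (hg : 0 < g)
    (N : ℕ) {x : ℝ} (hx : 0 ≤ x) :
    ∫⁻ u, ENNReal.ofReal (igPoly δ' g N (x + u) * Real.exp (-(g ^ 2 / 2) * (x + u)))
      ∂levyMeasure δ =
      ENNReal.ofReal (Real.exp (-(g ^ 2 / 2) * x - g * δ) *
        ∑ k ∈ Finset.range (N + 1),
          (N.choose k : ℝ) * igMoment δ g (N - k) * igPoly δ' g k x) := by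
  have hm := measurable_igPoly δ' g N
  -- Tilting turns the Lévy density into the inverse-Gaussian one, and the Appell identity expands
  -- the polynomial in powers of u, so the integral is a sum of moments.
  have e : ∀ u, levyPDF δ u * (igPoly δ' g N (x + u) * Real.exp (-(g ^ 2 / 2) * (x + u))) =
      Real.exp (-(g ^ 2 / 2) * x - g * δ) * ∑ k ∈ Finset.range (N + 1),
        (N.choose k : ℝ) * igPoly δ' g k x * (u ^ (N - k) * igPDF δ g u) := by
    intro u
    have := levyPDF_mul_exp hg δ u
    rw [mul_add, Real.exp_add, sub_eq_add_neg, Real.exp_add, ← neg_mul]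
    have e2 : ∑ k ∈ Finset.range (N + 1),
        (N.choose k : ℝ) * igPoly δ' g k x * (u ^ (N - k) * igPDF δ g u) =
        igPoly δ' g N (x + u) * igPDF δ g u := by
      rw [igPoly_add hδ' hg, Finset.sum_mul]
      exact Finset.sum_congr rfl fun k _ => by ring
    rw [e2]
    linear_combination (igPoly δ' g N (x + u) * Real.exp (-(g ^ 2 / 2) * x)) * this
  have hi : ∀ k ∈ Finset.range (N + 1), Integrable fun u =>
      (N.choose k : ℝ) * igPoly δ' g k x * (u ^ (N - k) * igPDF δ g u) :=
    fun k _ => (integrable_pow_mul_igPDF hδ hg _).const_mul _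
  rw [lintegral_levyMeasure_ofReal hδ (by fun_prop)]
  simp_rw [e]
  rw [← ofReal_integral_eq_lintegral_ofReal ((integrable_finsetSum _ hi).const_mul _)]
  · rw [integral_const_mul, integral_finsetSum _ hi]
    congr 2
    refine Finset.sum_congr rfl fun k _ => ?_
    rw [integral_const_mul, igMoment]; ring
  · refine Eventually.of_forall fun u => mul_nonneg (Real.exp_pos _).le
      (Finset.sum_nonneg fun k _ => ?_)
    have h1 := igPDF_nonneg hδ g u
    have h2 := igPoly_pos hδ' hg k hx
    rcases le_or_gt u 0 with hu | hu
    · simp [igPDF_of_nonpos hu]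
    · positivity

/-- Identifies the function h of the h-transform. The factor exp(gδ) undoes the one created by
tilting. -/
lemma gigMeasure_eq_withDensity {δ g : ℝ} (hδ : 0 < δ) (hg : 0 < g) (n : ℕ) :
    gigMeasure ((n : ℝ) - 1 / 2) δ g = (levyMeasure δ).withDensity fun x =>
      ENNReal.ofReal (Real.exp (g * δ) / igMoment δ g n *
        (x ^ n * Real.exp (-(g ^ 2 / 2) * x))) := by
  rw [gigMeasure, levyMeasure, ← withDensity_mul _ (measurable_levyPDF δ).ennreal_ofReal
    (by fun_prop)]
  congr 1
  ext x
  rw [Pi.mul_apply, ← ENNReal.ofReal_mul (levyPDF_nonneg hδ x), gigPDF_eq_pow_mul_igPDF hδ hg]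
  congr 1
  have h1 := levyPDF_mul_exp hg δ x
  have h2 : Real.exp (g * δ) * Real.exp (-g * δ) = 1 := by rw [← Real.exp_add]; simp
  linear_combination (-x ^ n * igPDF δ g x / igMoment δ g n) * h2 -
    x ^ n * Real.exp (g * δ) / igMoment δ g n * h1

/-! ### The transition density as a mixture -/

section Mixture

variable {c γ T s t : ℝ}

/-- The mixture as a ratio of polynomials times an inverse-Gaussian density. -/
lemma gigMixture_eq (hc : 0 < c) (hγ : 0 < γ) (hst : s < t) (htT : t < T) (n : ℕ) (x y : ℝ) :
    gigMixture n c γ T s t x y =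
      igPoly (c * (T - t)) γ n y * igPDF (c * (t - s)) γ (y - x) / igPoly (c * (T - s)) γ n x := by
  have h1 : 0 < c * (t - s) := mul_pos hc (sub_pos.2 hst)
  have h2 : 0 < c * (T - t) := mul_pos hc (sub_pos.2 htT)
  -- Expanding at y = x + (y - x) matches the mixture term by term: the moment in each weight
  -- cancels the normalising moment of the GIG density.
  have h3 := igPoly_add h2 hγ n x (y - x)
  rw [add_sub_cancel] at h3
  rw [h3, gigMixture, Finset.sum_mul, Finset.sum_div]
  refine Finset.sum_congr rfl fun k _ => ?_
  have := (igMoment_pos h1 hγ (n - k)).ne'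
  rw [gigPDF_eq_pow_mul_igPDF h1 hγ, gigWeight]
  field_simp

lemma measurable_gigMixture (n : ℕ) :
    Measurable (Function.uncurry (gigMixture n c γ T s t)) := by
  have h1 := fun k => measurable_igPoly (c * (T - t)) γ k
  have h2 := measurable_igPoly (c * (T - s)) γ n
  have h3 := fun lam => measurable_gigPDF lam (c * (t - s)) γ
  unfold gigMixture gigWeight Function.uncurry
  refine Finset.measurable_sum _ fun k _ => Measurable.mul ?_ ?_
  · exact ((((h1 k).comp measurable_fst).const_mul _)).div (h2.comp measurable_fst)
  · exact (h3 _).comp (measurable_snd.sub measurable_fst)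

lemma measurable_gigMixture_right (n : ℕ) (x : ℝ) : Measurable (gigMixture n c γ T s t x) :=
  (measurable_gigMixture n).of_uncurry_left

lemma gigMixture_nonneg (hc : 0 < c) (hγ : 0 < γ) (hst : s < t) (htT : t < T) (n : ℕ) {x : ℝ}
    (hx : 0 ≤ x) (y : ℝ) : 0 ≤ gigMixture n c γ T s t x y := by
  rw [gigMixture_eq hc hγ hst htT]
  have h1 : 0 < c * (t - s) := mul_pos hc (sub_pos.2 hst)
  have h2 : 0 < c * (T - t) := mul_pos hc (sub_pos.2 htT)
  have h3 : 0 < c * (T - s) := mul_pos hc (sub_pos.2 (hst.trans htT))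
  have h4 := igPDF_nonneg h1 γ (y - x)
  have h5 := igPoly_pos h3 hγ n hx
  rcases le_or_gt (y - x) 0 with hu | hu
  · simp [igPDF_of_nonpos hu]
  · have := igPoly_pos h2 hγ n (x := y) (by linarith)
    positivity

end Mixture

/-! ### From equal bridges to a change of measure -/

/-- Finite-dimensional distribution functions at rational points determine a law. -/
lemma measure_ext_of_forall_rat_le {ι : Type*} [Finite ι] {μ ν : Measure (ι → ℝ)}
    [IsProbabilityMeasure μ] [IsProbabilityMeasure ν]
    (h : ∀ q : ι → ℚ, μ {y | ∀ i, y i ≤ q i} = ν {y | ∀ i, y i ≤ q i}) : μ = ν := by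
  refine ext_of_generate_finite
    (Set.univ.pi '' Set.univ.pi fun _ : ι => ⋃ a : ℚ, {Set.Iic (a : ℝ)})
    (generateFrom_eq_pi (fun _ => ?_) fun _ => ?_).symm
    (IsPiSystem.pi fun _ => Real.isPiSystem_Iic_rat) ?_ (by simp)
  · rw [← Real.borel_eq_generateFrom_Iic_rat]; exact BorelSpace.measurable_eq.symm
  · refine ⟨fun m : ℕ => Set.Iic ((m : ℚ) : ℝ), fun m => Set.mem_iUnion.2 ⟨m, rfl⟩, ?_⟩
    refine Set.eq_univ_of_forall fun x => Set.mem_iUnion.2 ?_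
    obtain ⟨m, hm⟩ := exists_nat_ge x
    exact ⟨m, by simpa using hm⟩
  · rintro _ ⟨s, hs, rfl⟩
    have hs' : ∀ i, ∃ q : ℚ, Set.Iic (q : ℝ) = s i := fun i => by
      simpa using hs i (Set.mem_univ i)
    choose q hq using hs'
    have : Set.univ.pi s = {y : ι → ℝ | ∀ i, y i ≤ q i} := by
      ext y; simp [← hq]
    rw [this, h q]

section Transfer

variable {Ω Ω' : Type*} [MeasurableSpace Ω] [MeasurableSpace Ω']
  {P : Measure Ω} {P' : Measure Ω'} {T : ℝ≥0} {h : ℝ → ℝ≥0∞} {ξ : ℝ≥0 → Ω → ℝ} {S : ℝ≥0 → Ω' → ℝ}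

/-- Equal conditional laws given the terminal values turn a density of the terminal law into a
density of the joint law. -/
lemma lintegral_eq_of_condDistrib_eq [IsProbabilityMeasure P] [IsProbabilityMeasure P']
    {E : Type*} [MeasurableSpace E] [StandardBorelSpace E] [Nonempty E]
    {X : Ω → E} {X' : Ω' → E} {Z : Ω → ℝ} {Z' : Ω' → ℝ} (hX : Measurable X) (hX' : Measurable X')
    (hZ : Measurable Z) (hZ' : Measurable Z') (hh : Measurable h)
    (hZZ' : P.map Z = (P'.map Z').withDensity h)
    (hcond : ∀ᵐ z ∂(P.map Z), condDistrib X Z P z = condDistrib X' Z' P' z)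
    {ψ : E × ℝ → ℝ≥0∞} (hψ : Measurable ψ) :
    ∫⁻ ω, ψ (X ω, Z ω) ∂P = ∫⁻ ω, ψ (X' ω, Z' ω) * h (Z' ω) ∂P' := by
  have m1 : Measurable fun p : ℝ × E => ψ p.swap := hψ.comp measurable_swap
  have m2 : Measurable fun p : ℝ × E => h p.1 * ψ p.swap := (hh.comp measurable_fst).mul m1
  calc ∫⁻ ω, ψ (X ω, Z ω) ∂P
      = ∫⁻ p, ψ p.swap ∂(P.map fun ω => (Z ω, X ω)) := (lintegral_map m1 (hZ.prodMk hX)).symm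
    _ = ∫⁻ z, ∫⁻ y, ψ (y, z) ∂(condDistrib X Z P z) ∂(P.map Z) := by
      rw [← compProd_map_condDistrib hX.aemeasurable, Measure.lintegral_compProd m1]
      rfl
    _ = ∫⁻ z, ∫⁻ y, ψ (y, z) ∂(condDistrib X' Z' P' z) ∂(P.map Z) := by
      refine lintegral_congr_ae ?_
      filter_upwards [hcond] with z hz
      rw [hz]
    _ = ∫⁻ z, ∫⁻ y, h z * ψ (y, z) ∂(condDistrib X' Z' P' z) ∂(P'.map Z') := by
      rw [hZZ', lintegral_withDensity_eq_lintegral_mul _ hh]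
      · refine lintegral_congr fun z => ?_
        rw [Pi.mul_apply, lintegral_const_mul _ (by fun_prop)]
      · exact Measurable.lintegral_kernel_prod_right (f := fun z y => ψ (y, z)) m1
    _ = ∫⁻ p, h p.1 * ψ p.swap ∂(P'.map fun ω => (Z' ω, X' ω)) := by
      rw [← compProd_map_condDistrib hX'.aemeasurable, Measure.lintegral_compProd m2]
      rfl
    _ = _ := by
      rw [lintegral_map m2 (hZ'.prodMk hX')]
      simp only [Prod.swap_prod_mk, mul_comm]

/-- Up to time `T`, the law of `ξ` under `P` has the density `h (S T)` with respect to the law of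
`S` under `P'`, in the sense of finite-dimensional distributions. -/
def IsTerminalTransform (T : ℝ≥0) (h : ℝ → ℝ≥0∞) (ξ : ℝ≥0 → Ω → ℝ) (P : Measure Ω)
    (S : ℝ≥0 → Ω' → ℝ) (P' : Measure Ω') : Prop :=
  ∀ (F : Finset ℝ≥0), (∀ i ∈ F, i ≤ T) → ∀ ψ : (F → ℝ) → ℝ≥0∞, Measurable ψ →
    ∫⁻ ω, ψ (fun i => ξ i ω) ∂P = ∫⁻ ω, ψ (fun i => S i ω) * h (S T ω) ∂P'

/-- The bridge hypothesis covers increasing times strictly between 0 and T. An arbitrary finite set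
of times reduces to it because the value at 0 is almost surely 0 and the value at T is the
conditioning variable. -/
lemma isTerminalTransform_of_condDistrib [IsProbabilityMeasure P] [IsProbabilityMeasure P']
    (hξ : ∀ t ≤ T, Measurable (ξ t)) (hS : ∀ t, Measurable (S t))
    (hξ0 : ∀ᵐ ω ∂P, ξ 0 ω = 0) (hS0 : ∀ᵐ ω ∂P', S 0 ω = 0) (hh : Measurable h)
    (hT : P.map (ξ T) = (P'.map (S T)).withDensity h)
    (hcond : ∀ (k : ℕ) (t : Fin k → ℝ≥0), StrictMono t → (∀ i, 0 < t i ∧ t i < T) →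
      ∀ x : Fin k → ℝ, ∀ᵐ z ∂(P.map (ξ T)),
        condDistrib (fun ω i => ξ (t i) ω) (ξ T) P z {y | ∀ i, y i ≤ x i} =
          condDistrib (fun ω i => S (t i) ω) (S T) P' z {y | ∀ i, y i ≤ x i}) :
    IsTerminalTransform T h ξ P S P' := by
  classical
  intro F hF ψ hψ
  set G := F.filter fun i => 0 < i ∧ i < T with hG
  let t := G.orderEmbOfFin rfl
  have htG : ∀ j, t j ∈ G := fun j => G.orderEmbOfFin_mem rfl j
  have ht : ∀ j, 0 < t j ∧ t j < T := fun j => (Finset.mem_filter.1 (htG j)).2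
  have hex : ∀ i ∈ F, 0 < i → i < T → ∃ j, t j = i := by
    intro i hi h0 h1
    have : i ∈ Set.range t := by
      rw [Finset.range_orderEmbOfFin]; exact Finset.mem_filter.2 ⟨hi, h0, h1⟩
    exact this
  -- Rebuilds the path on `F` from its interior times and its terminal value; the default 0 serves
  -- the time 0.
  let Φ : (Fin G.card → ℝ) × ℝ → F → ℝ := fun p i =>
    if hi : ∃ j, t j = i then p.1 hi.choose else if (i : ℝ≥0) = T then p.2 else 0
  have hΦ : Measurable Φ := by
    refine measurable_pi_lambda _ fun i => ?_
    simp only [Φ]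
    split_ifs <;> fun_prop
  have hΦX : ∀ x : ℝ≥0 → ℝ, x 0 = 0 → (fun i : F => x i) = Φ (fun j => x (t j), x T) := by
    intro x hx0
    ext i
    simp only [Φ]
    split_ifs with h1 h2
    · rw [h1.choose_spec]
    · rw [h2]
    · rcases eq_or_lt_of_le (zero_le (a := (i : ℝ≥0))) with h3 | h3
      · rw [← h3, hx0]
      · exact absurd (hex i i.2 h3 (lt_of_le_of_ne (hF i i.2) h2)) h1
  have key := lintegral_eq_of_condDistrib_eq (P := P) (P' := P')
    (X := fun ω j => ξ (t j) ω) (X' := fun ω j => S (t j) ω)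
    (measurable_pi_lambda _ fun j => hξ _ (ht j).2.le) (measurable_pi_lambda _ fun j => hS _)
    (hξ T le_rfl) (hS T) hh hT ?_ (hψ.comp hΦ)
  · refine Eq.trans (lintegral_congr_ae ?_) (key.trans (lintegral_congr_ae ?_))
    · filter_upwards [hξ0] with ω hω
      rw [hΦX (fun i => ξ i ω) hω]; rfl
    · filter_upwards [hS0] with ω hω
      rw [hΦX (fun i => S i ω) hω]; rfl
  -- The exceptional null set depends on the orthant, so only the countably many rational orthants
  -- are used; they determine the law.
  · have := ae_all_iff.2 fun q : Fin G.card → ℚ =>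
      hcond G.card t t.strictMono ht (fun i => q i)
    filter_upwards [this] with z hz
    exact measure_ext_of_forall_rat_le hz

end Transfer

/-! ### Independence of the past and the next increment -/

section Increments

variable {Ω' : Type*} [MeasurableSpace Ω'] {P' : Measure Ω'} {S : ℝ≥0 → Ω' → ℝ}

/-- The increment of a process with independent increments after time `s` is independent of the
values of the process at finitely many times up to `s`. -/
lemma indepFun_finset_increment (hS : ∀ t, Measurable (S t)) (hS0 : ∀ᵐ ω ∂P', S 0 ω = 0)
    (hind : HasIndepIncrements S P') {s t : ℝ≥0} (hst : s ≤ t) (F : Finset ℝ≥0)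
    (hF : ∀ i ∈ F, i ≤ s) :
    IndepFun (fun ω (i : F) => S i ω) (fun ω => S t ω - S s ω) P' := by
  classical
  set k := F.card with hk
  let e : Fin k ≃o F := F.orderIsoOfFin rfl
  -- The times 0, the elements of `F` in order, s, then t forever. The inner test `j = 0` is needed
  -- because `0 - 1 = 0` in ℕ.
  let τ : ℕ → ℝ≥0 := fun j =>
    if hj : j - 1 < k then (if j = 0 then 0 else (e ⟨j - 1, hj⟩ : ℝ≥0))
    else if j = 0 then 0 else if j = k + 1 then s else t
  have hτ0 : τ 0 = 0 := by simp only [τ]; split_ifs <;> simp_all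
  have hτ1 : ∀ j : Fin k, τ (j + 1) = e j := by
    intro j; simp [τ]
  have hτ2 : τ (k + 1) = s := by simp [τ]
  have hτ3 : τ (k + 2) = t := by simp [τ]
  have hmono : Monotone τ := by
    refine monotone_nat_of_le_succ fun j => ?_
    rcases j with _ | j
    · rw [hτ0]; exact zero_le
    · by_cases h1 : j + 1 < k
      · rw [hτ1 ⟨j, by omega⟩, hτ1 ⟨j + 1, h1⟩]
        exact e.monotone (by simp [Fin.le_def])
      · by_cases h2 : j < k
        · rw [hτ1 ⟨j, h2⟩, show j + 1 + 1 = k + 1 by omega, hτ2]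
          exact hF _ (e _).2
        · by_cases h3 : j = k
          · subst h3; rw [hτ2, hτ3]; exact hst
          · have h4 : ¬ (j < k) := h2
            have h5 : ¬ (j + 1 < k) := h1
            have h6 : j + 1 ≠ k := by omega
            simp [τ, h4, h5, h3, h6]
  have hi := hind.nat hmono
  have hpair := hi.indepFun_finset (Finset.range (k + 1)) {k + 1} (by simp)
    (fun i => (hS _).sub (hS _))
  -- As S_0 = 0, values of S on `F` are partial sums of the increments numbered 0 to k, while
  -- increment k + 1 runs from s to t.
  let Φ : (Finset.range (k + 1) → ℝ) → F → ℝ := fun x i =>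
    ∑ j : Finset.range (k + 1), if (j : ℕ) ≤ e.symm i then x j else 0
  have hΦ : Measurable Φ := by
    refine measurable_pi_lambda _ fun i => Finset.measurable_sum _ fun j _ => ?_
    split_ifs <;> fun_prop
  have hcomp := hpair.comp hΦ (measurable_pi_apply (⟨k + 1, by simp⟩ : ({k + 1} : Finset ℕ)))
  refine hcomp.congr ?_ ?_
  · filter_upwards [hS0] with ω hω
    ext i
    have h1 : ∀ m : ℕ, S (τ m) ω = ∑ j ∈ Finset.range m, (S (τ (j + 1)) ω - S (τ j) ω) := by
      intro m
      rw [Finset.sum_range_sub (fun j => S (τ j) ω), hτ0, hω, sub_zero]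
    have h2 : (i : ℝ≥0) = τ (e.symm i + 1) := by rw [hτ1]; simp
    rw [h2, h1]
    simp only [Φ, Function.comp]
    rw [Finset.sum_coe_sort (Finset.range (k + 1)) (fun j : ℕ =>
      if j ≤ e.symm i then S (τ (j + 1)) ω - S (τ j) ω else 0), ← Finset.sum_filter]
    refine Finset.sum_congr ?_ fun _ _ => rfl
    ext j
    have := (e.symm i).2
    simp only [Finset.mem_filter, Finset.mem_range]
    omega
  · refine Eventually.of_forall fun ω => ?_
    simp only [Function.comp]
    rw [hτ2, show k + 1 + 1 = k + 2 from rfl, hτ3]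

/-- Integrating out the increment of a Lévy process after time `s`. -/
lemma lintegral_finset_increment [IsProbabilityMeasure P'] (hS : IsLevyProcess S P') {s t : ℝ≥0}
    (hst : s ≤ t) (F : Finset ℝ≥0) (hF : ∀ i ∈ F, i ≤ s) {Ψ : (F → ℝ) × ℝ → ℝ≥0∞}
    (hΨ : Measurable Ψ) :
    ∫⁻ ω, Ψ (fun i => S i ω, S t ω - S s ω) ∂P' =
      ∫⁻ ω, ∫⁻ u, Ψ (fun i => S i ω, u) ∂(P'.map (S (t - s))) ∂P' := by
  have hm : Measurable fun ω (i : F) => S i ω := measurable_pi_lambda _ fun i => hS.measurable _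
  have hm2 : Measurable fun ω => S t ω - S s ω := (hS.measurable _).sub (hS.measurable _)
  have hi := indepFun_finset_increment hS.measurable hS.start hS.indep hst F hF
  rw [indepFun_iff_map_prod_eq_prod_map_map hm.aemeasurable hm2.aemeasurable] at hi
  have hstat := hS.stationary s (t - s)
  rw [add_tsub_cancel_of_le hst] at hstat
  have := Measure.isProbabilityMeasure_map (μ := P') (hS.measurable (t - s)).aemeasurable
  rw [← lintegral_map hΨ (hm.prodMk hm2), hi, hstat, lintegral_prod _ hΨ.aemeasurable,
    lintegral_map (Measurable.lintegral_prod_right' hΨ) hm]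

end Increments

/-! ### The h-transformed semigroup and the Markov property -/

section Markov

variable {Ω Ω' : Type*} [MeasurableSpace Ω] [MeasurableSpace Ω']
  {P : Measure Ω} {P' : Measure Ω'} {T : ℝ≥0} {h : ℝ → ℝ≥0∞} {ξ : ℝ≥0 → Ω → ℝ} {S : ℝ≥0 → Ω' → ℝ}

/-- The value `x ↦ E[h (x + S_r)]` of the semigroup of `S` applied to `h`. -/
noncomputable def levySemigroup (S : ℝ≥0 → Ω' → ℝ) (P' : Measure Ω') (r : ℝ≥0) (h : ℝ → ℝ≥0∞)
    (x : ℝ) : ℝ≥0∞ :=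
  ∫⁻ v, h (x + v) ∂(P'.map (S r))

lemma measurable_levySemigroup [IsProbabilityMeasure P'] (r : ℝ≥0) (hh : Measurable h) :
    Measurable (levySemigroup S P' r h) :=
  Measurable.lintegral_prod_right' (f := fun p : ℝ × ℝ => h (p.1 + p.2))
    (hh.comp (measurable_fst.add measurable_snd))

/-- Conditioning on finitely many values up to time `s`. -/
lemma lintegral_mul_comp_levy [IsProbabilityMeasure P'] (hS : IsLevyProcess S P') {s t : ℝ≥0}
    (hst : s ≤ t) (F : Finset ℝ≥0) (hF : ∀ i ∈ F, i ≤ s) (hs : s ∈ F) {ψ : (F → ℝ) → ℝ≥0∞}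
    (hψ : Measurable ψ) (hh : Measurable h) :
    ∫⁻ ω, ψ (fun i => S i ω) * h (S t ω) ∂P' =
      ∫⁻ ω, ψ (fun i => S i ω) * levySemigroup S P' (t - s) h (S s ω) ∂P' := by
  have hm : Measurable fun p : (F → ℝ) × ℝ => ψ p.1 * h (p.1 ⟨s, hs⟩ + p.2) := by fun_prop
  have := lintegral_finset_increment hS hst F hF hm
  simp only [add_sub_cancel] at this
  rw [this]
  refine lintegral_congr fun ω => ?_
  rw [lintegral_const_mul _ (by fun_prop), levySemigroup]

lemma levySemigroup_zero (hS0 : ∀ᵐ ω ∂P', S 0 ω = 0) [IsProbabilityMeasure P']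
    (hS : Measurable (S 0)) (hh : Measurable h) (x : ℝ) : levySemigroup S P' 0 h x = h x := by
  rw [levySemigroup, lintegral_map (by fun_prop) hS]
  rw [lintegral_congr_ae (g := fun _ => h x)]
  · simp
  · filter_upwards [hS0] with ω hω
    rw [hω, add_zero]

/-- The Chapman–Kolmogorov equation. -/
lemma levySemigroup_add [IsProbabilityMeasure P'] (hS : IsLevyProcess S P') (r q : ℝ≥0)
    (hh : Measurable h) (x : ℝ) :
    levySemigroup S P' (r + q) h x = levySemigroup S P' r (levySemigroup S P' q h) x := by
  have := lintegral_mul_comp_levy (h := fun y => h (x + y)) hS (le_self_add : r ≤ r + q) {r}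
    (by simp) (by simp) (ψ := fun _ => 1) measurable_const (by fun_prop)
  simp only [one_mul, add_tsub_cancel_left] at this
  rw [levySemigroup, lintegral_map (by fun_prop) (hS.measurable _), this, levySemigroup,
    lintegral_map (f := fun v => levySemigroup S P' q h (x + v))
      ((measurable_levySemigroup q hh).comp (by fun_prop)) (hS.measurable _)]
  simp only [levySemigroup, add_assoc]

/-- The density of the law of the path up to time `s`. -/
lemma IsTerminalTransform.lintegral_eq [IsProbabilityMeasure P']
    (hT : IsTerminalTransform T h ξ P S P') (hS : IsLevyProcess S P') (hh : Measurable h)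
    {s : ℝ≥0} (hsT : s ≤ T) (F : Finset ℝ≥0) (hF : ∀ i ∈ F, i ≤ s) (hs : s ∈ F)
    {ψ : (F → ℝ) → ℝ≥0∞} (hψ : Measurable ψ) :
    ∫⁻ ω, ψ (fun i => ξ i ω) ∂P =
      ∫⁻ ω, ψ (fun i => S i ω) * levySemigroup S P' (T - s) h (S s ω) ∂P' := by
  rw [hT F (fun i hi => (hF i hi).trans hsT) ψ hψ, lintegral_mul_comp_levy hS hsT F hF hs hψ hh]

/-- Almost sure properties of `S t` are inherited by `ξ t`. -/
lemma IsTerminalTransform.ae_of_ae (hT : IsTerminalTransform T h ξ P S P') {t : ℝ≥0} (htT : t ≤ T)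
    (hξt : Measurable (ξ t)) {A : Set ℝ} (hA : MeasurableSet A) (h1 : ∀ᵐ ω ∂P', S t ω ∈ A) :
    ∀ᵐ ω ∂P, ξ t ω ∈ A := by
  have hm : Measurable fun x : (({t} : Finset ℝ≥0) → ℝ) =>
      Aᶜ.indicator (fun _ => (1 : ℝ≥0∞)) (x ⟨t, by simp⟩) :=
    (measurable_const.indicator hA.compl).comp (measurable_pi_apply _)
  have h2 := hT {t} (by simpa using htT) _ hm
  have h3 : ∫⁻ ω, Aᶜ.indicator (fun _ => (1 : ℝ≥0∞)) (S t ω) * h (S T ω) ∂P' = 0 := by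
    rw [lintegral_congr_ae (g := fun _ => 0), lintegral_zero]
    filter_upwards [h1] with ω hω
    simp [hω]
  simp only [h3] at h2
  rw [lintegral_eq_zero_iff (f := fun ω => Aᶜ.indicator (fun _ => (1 : ℝ≥0∞)) (ξ t ω))
    ((measurable_const.indicator hA.compl).comp hξt)] at h2
  filter_upwards [h2] with ω hω
  by_contra hcon
  simp [hcon] at hω

/-- The Markov property: the conditional expectation of `φ (ξ t)` given the past up to time `s` is
`G (ξ s)`, where `G` is the transformed semigroup applied to `φ`. -/
lemma IsTerminalTransform.setLIntegral_eq [IsProbabilityMeasure P'] [IsProbabilityMeasure P]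
    (hT : IsTerminalTransform T h ξ P S P') (hS : IsLevyProcess S P') (hh : Measurable h)
    (hξ : ∀ t ≤ T, Measurable (ξ t)) (hpos : ∀ t, ∀ᵐ ω ∂P', 0 ≤ S t ω)
    {s t : ℝ≥0} (hst : s ≤ t) (htT : t ≤ T) {φ G : ℝ → ℝ≥0∞} (hφ : Measurable φ)
    (hG : Measurable G) (hfin : ∫⁻ ω, φ (ξ t ω) ∂P ≠ ∞)
    (hGφ : ∀ x, 0 ≤ x → levySemigroup S P' (t - s)
      (fun y => φ y * levySemigroup S P' (T - t) h y) x = G x * levySemigroup S P' (T - s) h x)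
    {A : Set Ω} (hA : MeasurableSet[naturalSigma ξ s] A) :
    ∫⁻ ω in A, φ (ξ t ω) ∂P = ∫⁻ ω in A, G (ξ s ω) ∂P := by
  classical
  have hsT := hst.trans htT
  have hmH : ∀ r, Measurable (levySemigroup S P' r h) := fun r => measurable_levySemigroup r hh
  -- The claim on cylinders. Both sides become expectations for S at time s, where the assumed
  -- identity applies since S_s ≥ 0.
  have hcyl : ∀ (F : Finset ℝ≥0), (∀ i ∈ F, i ≤ s) → s ∈ F → ∀ ψ : (F → ℝ) → ℝ≥0∞, Measurable ψ →
      ∫⁻ ω, ψ (fun i => ξ i ω) * φ (ξ t ω) ∂P = ∫⁻ ω, ψ (fun i => ξ i ω) * G (ξ s ω) ∂P := by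
    intro F hF hsF ψ hψ
    have e1 := hT.lintegral_eq hS hh htT (insert t F)
      (fun i hi => (Finset.mem_insert.1 hi).elim (fun h => h.le) fun h => (hF i h).trans hst)
      (Finset.mem_insert_self _ _)
      (ψ := fun x => ψ (fun i => x ⟨i, Finset.mem_insert_of_mem i.2⟩) *
        φ (x ⟨t, Finset.mem_insert_self _ _⟩)) (by fun_prop)
    have e2 := hT.lintegral_eq hS hh hsT F hF hsF (ψ := fun x => ψ x * G (x ⟨s, hsF⟩))
      (by fun_prop)
    have e3 := lintegral_mul_comp_levy (h := fun y => φ y * levySemigroup S P' (T - t) h y)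
      hS hst F hF hsF hψ (hφ.mul (hmH _))
    simp only [mul_assoc] at e1 e2 e3
    rw [e1, e2, e3]
    refine lintegral_congr_ae ?_
    filter_upwards [hpos s] with ω hω
    rw [hGφ _ hω]
  have hle : ∀ i ∈ Set.Iic s, MeasurableSpace.comap (ξ i) inferInstance ≤ ‹MeasurableSpace Ω› :=
    fun i hi => (hξ i (le_trans hi hsT)).comap_le
  have hm : naturalSigma ξ s ≤ ‹MeasurableSpace Ω› := iSup₂_le hle
  have hset : ∀ A, MeasurableSet A → ∀ X : Ω → ℝ≥0∞,
      ∫⁻ ω in A, X ω ∂P = ∫⁻ ω, A.indicator (fun _ => 1) ω * X ω ∂P := by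
    intro A hA X
    rw [← lintegral_indicator hA]
    refine lintegral_congr fun ω => ?_
    by_cases h : ω ∈ A <;> simp [h]
  have huniv : ∫⁻ ω, φ (ξ t ω) ∂P = ∫⁻ ω, G (ξ s ω) ∂P := by
    simpa using hcyl {s} (by simp) (by simp) (fun _ => 1) measurable_const
  -- Extension from cylinders to the whole past: two measures with equal mass, finite by `hfin`,
  -- agree on a π-system generating `naturalSigma ξ s`.
  let μ := P.withDensity fun ω => φ (ξ t ω)
  have : IsFiniteMeasure μ := isFiniteMeasure_withDensity hfin
  have hμν := ext_on_measurableSpace_of_generate_finite (μ := μ)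
    (ν := P.withDensity fun ω => G (ξ s ω)) ‹_› _ ?_ hm
    (generateFrom_piiUnionInter_measurableSet
      (fun i => MeasurableSpace.comap (ξ i) inferInstance) (Set.Iic s)).symm
    (isPiSystem_piiUnionInter _ (fun i => @MeasurableSpace.isPiSystem_measurableSet Ω
      (MeasurableSpace.comap (ξ i) inferInstance)) _) ?_ hA
  · rwa [withDensity_apply _ (hm _ hA), withDensity_apply _ (hm _ hA)] at hμν
  · rintro _ ⟨F, hFs, f, hf, rfl⟩
    have hmeas : MeasurableSet (⋂ i ∈ F, f i) :=
      Finset.measurableSet_biInter _ fun i hi => hle i (hFs hi) _ (hf i hi)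
    rw [withDensity_apply _ hmeas, withDensity_apply _ hmeas, hset _ hmeas, hset _ hmeas]
    have hB : ∀ i, ∃ B : Set ℝ, MeasurableSet B ∧ (i ∈ F → ξ i ⁻¹' B = f i) := by
      intro i
      by_cases hi : i ∈ F
      · obtain ⟨B, hB, hBf⟩ := hf i hi
        exact ⟨B, hB, fun _ => hBf⟩
      · exact ⟨Set.univ, MeasurableSet.univ, fun h => absurd h hi⟩
    choose B hBm hB using hB
    -- The time s is added without constraint, because the cylinder identity requires it among the
    -- observed times.
    let C : Set (↥(insert s F) → ℝ) := {x | ∀ i : ↥(insert s F), (i : ℝ≥0) ∈ F → x i ∈ B i}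
    have hC : MeasurableSet C := by
      have : C = ⋂ i : ↥(insert s F), {x | (i : ℝ≥0) ∈ F → x i ∈ B i} := by
        ext; simp [C]
      rw [this]
      refine MeasurableSet.iInter fun i => ?_
      by_cases hi : (i : ℝ≥0) ∈ F
      · simp only [hi, true_imp_iff]
        exact (measurable_pi_apply i : Measurable fun x : ↥(insert s F) → ℝ => x i) (hBm i)
      · simp [hi]
    have hCA : ∀ ω, (⋂ i ∈ F, f i).indicator (fun _ => (1 : ℝ≥0∞)) ω =
        C.indicator (fun _ => 1) (fun i => ξ i ω) := by
      intro ω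
      refine Set.indicator_eq_indicator ?_ rfl
      simp only [C, Set.mem_iInter, Set.mem_ofPred_eq, Subtype.forall]
      constructor
      · intro h i _ hi
        have := h i hi
        rwa [← hB i hi] at this
      · intro h i hi
        rw [← hB i hi]
        exact h i (Finset.mem_insert_of_mem hi) hi
    simp only [hCA]
    refine hcyl (insert s F) ?_ (Finset.mem_insert_self _ _) (C.indicator fun _ => 1)
      (measurable_const.indicator hC)
    intro i hi
    rcases Finset.mem_insert.1 hi with h | h
    · exact h.le
    · exact hFs h
  · simpa [μ, withDensity_apply] using huniv

end Markov

/-! ### Explicit action of the semigroup of the subordinator -/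

/-- A criterion for conditional expectations of non-negative variables in terms of Lebesgue
integrals. -/
lemma condExp_ae_eq_of_setLIntegral_eq {Ω : Type*} {m m₀ : MeasurableSpace Ω} {P : Measure Ω}
    [IsProbabilityMeasure P] (hm : m ≤ m₀) {X Y : Ω → ℝ} (hX : Measurable X)
    (hY : Measurable[m] Y) (hX0 : 0 ≤ᵐ[P] X) (hY0 : 0 ≤ᵐ[P] Y)
    (hfin : ∫⁻ ω, ENNReal.ofReal (X ω) ∂P ≠ ∞)
    (h : ∀ A, MeasurableSet[m] A →
      ∫⁻ ω in A, ENNReal.ofReal (X ω) ∂P = ∫⁻ ω in A, ENNReal.ofReal (Y ω) ∂P) :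
    P[X | m] =ᵐ[P] Y := by
  have hY' : Measurable Y := hY.mono hm le_rfl
  have hXi : Integrable X P :=
    (lintegral_ofReal_ne_top_iff_integrable hX.aestronglyMeasurable hX0).1 hfin
  have hYi : Integrable Y P := by
    refine (lintegral_ofReal_ne_top_iff_integrable hY'.aestronglyMeasurable hY0).1 ?_
    have := h Set.univ MeasurableSet.univ
    rw [Measure.restrict_univ] at this
    rwa [← this]
  refine (ae_eq_condExp_of_forall_setIntegral_eq hm hXi (fun _ _ _ => hYi.integrableOn)
    (fun A hA _ => ?_) hY.stronglyMeasurable.aestronglyMeasurable).symm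
  rw [integral_eq_lintegral_of_nonneg_ae (ae_restrict_of_ae hX0) hX.aestronglyMeasurable,
    integral_eq_lintegral_of_nonneg_ae (ae_restrict_of_ae hY0) hY'.aestronglyMeasurable, h A hA]

/-- The density of the `GIG(n - 1/2, δ, γ)` law with respect to the Lévy law with parameter `δ`. -/
noncomputable def gigTilt (n : ℕ) (δ γ x : ℝ) : ℝ≥0∞ :=
  ENNReal.ofReal (Real.exp (γ * δ) / igMoment δ γ n * (x ^ n * Real.exp (-(γ ^ 2 / 2) * x)))

lemma measurable_gigTilt (n : ℕ) (δ γ : ℝ) : Measurable (gigTilt n δ γ) := by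
  unfold gigTilt; fun_prop

section Semigroup

variable {Ω' : Type*} [MeasurableSpace Ω'] {P' : Measure Ω'}
  {c γ : ℝ} {S : ℝ≥0 → Ω' → ℝ}

lemma IsStableHalfSubordinator.ae_nonneg (hS : IsStableHalfSubordinator c S P') (t : ℝ≥0) :
    ∀ᵐ ω ∂P', 0 ≤ S t ω := by
  filter_upwards [hS.start, hS.increasing] with ω h0 hmono
  rw [← h0]
  exact hmono zero_le

/-- From x ≥ 0 the subordinator stays in [0, ∞), so formulas valid only there can be substituted
inside the semigroup. -/
lemma levySemigroup_congr (hS : IsStableHalfSubordinator c S P') {f g : ℝ → ℝ≥0∞}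
    (hfg : ∀ y, 0 ≤ y → f y = g y) (r : ℝ≥0) {x : ℝ} (hx : 0 ≤ x) :
    levySemigroup S P' r f x = levySemigroup S P' r g x := by
  have h1 : ∀ᵐ v ∂(P'.map (S r)), v ∈ Set.Ici (0 : ℝ) :=
    (ae_map_iff (hS.measurable r).aemeasurable measurableSet_Ici).2 (hS.ae_nonneg r)
  refine lintegral_congr_ae ?_
  filter_upwards [h1] with v hv
  exact hfg _ (add_nonneg hx hv)

lemma levySemigroup_eq (hS : IsStableHalfSubordinator c S P') {r : ℝ≥0} (hr : 0 < r)
    (f : ℝ → ℝ≥0∞) (x : ℝ) :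
    levySemigroup S P' r f x = ∫⁻ v, f (x + v) ∂levyMeasure (c * r) := by
  rw [levySemigroup, hS.law r hr, levyMeasure]

lemma levySemigroup_pow_mul_exp (hS : IsStableHalfSubordinator c S P') (hc : 0 < c) {g : ℝ}
    (hg : 0 < g) {K : ℝ} (hK : 0 ≤ K) (N : ℕ) {r : ℝ≥0} (hr : 0 < r) {x : ℝ} (hx : 0 ≤ x) :
    levySemigroup S P' r (fun y => ENNReal.ofReal (K * (y ^ N * Real.exp (-(g ^ 2 / 2) * y)))) x =
      ENNReal.ofReal (K * (Real.exp (-(g ^ 2 / 2) * x - g * (c * r)) * igPoly (c * r) g N x)) := by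
  rw [levySemigroup_eq hS hr, ENNReal.ofReal_mul hK,
    ← lintegral_levyMeasure_pow_mul_exp (by positivity) hg N hx,
    ← lintegral_const_mul _ (by fun_prop)]
  simp_rw [ENNReal.ofReal_mul hK]

lemma levySemigroup_gigTilt (hS : IsStableHalfSubordinator c S P') (hc : 0 < c) (hγ : 0 < γ)
    (n : ℕ) {T s : ℝ≥0} (hsT : s < T) {x : ℝ} (hx : 0 ≤ x) :
    levySemigroup S P' (T - s) (gigTilt n (c * T) γ) x =
      ENNReal.ofReal (Real.exp (γ * (c * T)) / igMoment (c * T) γ n *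
        (Real.exp (-(γ ^ 2 / 2) * x - γ * (c * (T - s))) * igPoly (c * (T - s)) γ n x)) := by
  have hT : 0 < T := (zero_le (a := s)).trans_lt hsT
  have := igMoment_pos (δ := c * T) (g := γ) (by positivity) hγ n
  rw [← NNReal.coe_sub hsT.le]
  exact levySemigroup_pow_mul_exp hS hc hγ (by positivity) n (tsub_pos_of_lt hsT) hx

variable [IsProbabilityMeasure P']

/-- The convolution identity for the moments of inverse-Gaussian laws. -/
lemma sum_igMoment_mul_igPoly (hS : IsStableHalfSubordinator c S P') (hc : 0 < c) (hγ : 0 < γ)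
    (N : ℕ) {r q : ℝ≥0} (hr : 0 < r) (hq : 0 < q) {x : ℝ} (hx : 0 ≤ x) :
    ∑ k ∈ Finset.range (N + 1),
      (N.choose k : ℝ) * igMoment (c * r) γ (N - k) * igPoly (c * q) γ k x =
        igPoly (c * (r + q)) γ N x := by
  have hcr : 0 < c * r := by positivity
  have hcq : 0 < c * q := by positivity
  have hm := measurable_igPoly (c * q) γ N
  -- Both sides of Chapman–Kolmogorov are evaluated on y^N exp(-γ²y/2): in one step of length r + q,
  -- and in steps q and r. The exponential factors agree and cancel.
  have h1 := levySemigroup_add (h := fun y =>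
    ENNReal.ofReal (1 * (y ^ N * Real.exp (-(γ ^ 2 / 2) * y)))) hS.toIsLevyProcess r q
    (by fun_prop) x
  rw [levySemigroup_pow_mul_exp hS hc hγ zero_le_one N (by positivity) hx,
    levySemigroup_congr hS (fun y hy => levySemigroup_pow_mul_exp hS hc hγ zero_le_one N hq hy)
      r hx, levySemigroup_eq hS hr] at h1
  have h2 : ∀ v, ENNReal.ofReal (1 * (Real.exp (-(γ ^ 2 / 2) * (x + v) - γ * (c * q)) *
      igPoly (c * q) γ N (x + v))) = ENNReal.ofReal (Real.exp (-(γ * (c * q)))) *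
        ENNReal.ofReal (igPoly (c * q) γ N (x + v) * Real.exp (-(γ ^ 2 / 2) * (x + v))) := by
    intro v
    rw [← ENNReal.ofReal_mul (Real.exp_pos _).le, sub_eq_add_neg, Real.exp_add]
    ring_nf
  simp_rw [h2] at h1
  rw [lintegral_const_mul _ (by fun_prop), lintegral_levyMeasure_igPoly_mul_exp hcr hcq hγ N hx,
    ← ENNReal.ofReal_mul (Real.exp_pos _).le, ENNReal.ofReal_eq_ofReal_iff] at h1
  · push_cast at h1
    have h3 : Real.exp (-(γ ^ 2 / 2) * x - γ * (c * (r + q))) =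
        Real.exp (-(γ * (c * q))) * Real.exp (-(γ ^ 2 / 2) * x - γ * (c * r)) := by
      rw [← Real.exp_add]; congr 1; ring
    rw [h3, one_mul, mul_assoc] at h1
    exact (mul_left_cancel₀ (Real.exp_pos _).ne'
      (mul_left_cancel₀ (Real.exp_pos _).ne' h1)).symm
  · have := igPoly_pos (δ := c * ((r + q : ℝ≥0) : ℝ)) (g := γ) (by positivity) hγ N hx
    positivity
  · have : 0 ≤ ∑ k ∈ Finset.range (N + 1),
        (N.choose k : ℝ) * igMoment (c * r) γ (N - k) * igPoly (c * q) γ k x :=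
      Finset.sum_nonneg fun k _ => by
        have := igMoment_pos hcr hγ (N - k)
        have := igPoly_pos hcq hγ k hx
        positivity
    positivity

lemma gigWeight_nonneg (hc : 0 < c) (hγ : 0 < γ) (n : ℕ) {T s t : ℝ} (hst : s < t) (htT : t < T)
    {x : ℝ} (hx : 0 ≤ x) (k : ℕ) : 0 ≤ gigWeight n c γ T s t k x := by
  have h1 : 0 < c * (t - s) := mul_pos hc (sub_pos.2 hst)
  have h2 : 0 < c * (T - t) := mul_pos hc (sub_pos.2 htT)
  have h3 : 0 < c * (T - s) := mul_pos hc (sub_pos.2 (hst.trans htT))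
  have := igMoment_pos h1 hγ (n - k)
  have := igPoly_pos h2 hγ k hx
  have := igPoly_pos h3 hγ n hx
  unfold gigWeight
  positivity

lemma sum_gigWeight (hS : IsStableHalfSubordinator c S P') (hc : 0 < c) (hγ : 0 < γ) (n : ℕ)
    {T s t : ℝ≥0} (hst : s < t) (htT : t < T) {x : ℝ} (hx : 0 ≤ x) :
    ∑ k ∈ Finset.range (n + 1), gigWeight n c γ T s t k x = 1 := by
  have h := sum_igMoment_mul_igPoly hS hc hγ n (tsub_pos_of_lt hst) (tsub_pos_of_lt htT) hx
  rw [NNReal.coe_sub hst.le, NNReal.coe_sub htT.le,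
    show ((t : ℝ) - s) + (T - t) = T - s by ring] at h
  simp only [gigWeight]
  rw [← Finset.sum_div, h, div_self]
  exact (igPoly_pos (mul_pos hc (sub_pos.2 (NNReal.coe_lt_coe.2 (hst.trans htT)))) hγ n hx).ne'

/-- The transition kernel of the bridge in terms of the semigroup of the subordinator. -/
lemma levySemigroup_indicator_mul (hS : IsStableHalfSubordinator c S P') (hc : 0 < c) (hγ : 0 < γ)
    (n : ℕ) {T s t : ℝ≥0} (hst : s < t) (htT : t < T) {B : Set ℝ} (hB : MeasurableSet B) {x : ℝ}
    (hx : 0 ≤ x) :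
    levySemigroup S P' (t - s)
      (fun y => B.indicator (fun _ => 1) y * levySemigroup S P' (T - t) (gigTilt n (c * T) γ) y) x =
      (∫⁻ y in B, ENNReal.ofReal (gigMixture n c γ T s t x y)) *
        levySemigroup S P' (T - s) (gigTilt n (c * T) γ) x := by
  have hst' : (s : ℝ) < t := NNReal.coe_lt_coe.2 hst
  have htT' : (t : ℝ) < T := NNReal.coe_lt_coe.2 htT
  obtain ⟨K, hH⟩ : ∃ K : ℝ, ∀ r : ℝ≥0, r < T → ∀ y, 0 ≤ y →
      levySemigroup S P' (T - r) (gigTilt n (c * T) γ) y =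
        ENNReal.ofReal (K * (Real.exp (-(γ ^ 2 / 2) * y - γ * (c * (T - r))) *
          igPoly (c * (T - r)) γ n y)) :=
    ⟨_, fun r hr y hy => levySemigroup_gigTilt hS hc hγ n hr hy⟩
  have hm := measurable_igPoly (c * (T - t)) γ n
  have hl := measurable_levyPDF (c * (t - s))
  have hind : Measurable (B.indicator fun _ : ℝ => (1 : ℝ≥0∞)) := measurable_const.indicator hB
  have hmix : Measurable fun y => gigMixture n c γ T s t x y := measurable_gigMixture_right n x
  have hcts : 0 < c * ((t : ℝ) - s) := mul_pos hc (sub_pos.2 hst')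
  rw [levySemigroup_congr hS (fun y hy => by rw [hH t htT y hy]) _ hx, hH s (hst.trans htT) x hx,
    levySemigroup_eq hS (tsub_pos_of_lt hst), lintegral_levyMeasure _ (by fun_prop),
    NNReal.coe_sub hst.le]
  have hshift := lintegral_add_left_eq_self (μ := volume) (fun y =>
    ENNReal.ofReal (levyPDF (c * (t - s)) (y - x)) * (B.indicator (fun _ => 1) y *
      ENNReal.ofReal (K * (Real.exp (-(γ ^ 2 / 2) * y - γ * (c * (T - t))) *
        igPoly (c * (T - t)) γ n y)))) x
  simp only [add_sub_cancel_left] at hshift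
  rw [hshift, ← lintegral_mul_const _ hmix.ennreal_ofReal, ← lintegral_indicator hB]
  refine lintegral_congr fun y => ?_
  by_cases hy : y ∈ B
  · rw [Set.indicator_of_mem hy, Set.indicator_of_mem hy, one_mul,
      ← ENNReal.ofReal_mul (levyPDF_nonneg hcts _),
      ← ENNReal.ofReal_mul (gigMixture_nonneg hc hγ hst' htT' n hx y),
      gigMixture_eq hc hγ hst' htT']
    congr 1
    have h1 := levyPDF_mul_exp hγ (c * ((t : ℝ) - s)) (y - x)
    have h2 := (igPoly_pos (mul_pos hc (sub_pos.2 (hst'.trans htT'))) hγ n hx).ne'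
    have h3 : Real.exp (-(γ ^ 2 / 2) * y - γ * (c * (T - t))) =
        Real.exp (-(γ ^ 2 / 2) * (y - x)) *
          Real.exp (-(γ ^ 2 / 2) * x - γ * (c * (T - t))) := by
      rw [← Real.exp_add]; congr 1; ring
    have h4 : Real.exp (-(γ ^ 2 / 2) * x - γ * (c * (T - s))) =
        Real.exp (-γ * (c * (t - s))) * Real.exp (-(γ ^ 2 / 2) * x - γ * (c * (T - t))) := by
      rw [← Real.exp_add]; congr 1; ring
    rw [h3, h4, div_mul_eq_mul_div, eq_div_iff h2]
    linear_combination (K * Real.exp (-(γ ^ 2 / 2) * x - γ * (c * (T - t))) *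
      igPoly (c * (T - t)) γ n y * igPoly (c * (T - s)) γ n x) * h1
  · rw [Set.indicator_of_notMem hy, Set.indicator_of_notMem hy, zero_mul, mul_zero]

/-- With B the whole line, `levySemigroup_indicator_mul` and Chapman–Kolmogorov both evaluate
Q_{t-s} Q_{T-t} h; the factor Q_{T-s} h(x) is positive and finite, hence cancels. -/
lemma lintegral_gigMixture (hS : IsStableHalfSubordinator c S P') (hc : 0 < c) (hγ : 0 < γ)
    (n : ℕ) {T s t : ℝ≥0} (hst : s < t) (htT : t < T) {x : ℝ} (hx : 0 ≤ x) :
    ∫⁻ y, ENNReal.ofReal (gigMixture n c γ T s t x y) = 1 := by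
  have hT : 0 < T := (zero_le (a := t)).trans_lt htT
  have h1 := levySemigroup_indicator_mul hS hc hγ n hst htT MeasurableSet.univ hx
  have h2 := levySemigroup_add (h := gigTilt n (c * T) γ) hS.toIsLevyProcess (t - s) (T - t)
    (measurable_gigTilt _ _ _) x
  rw [add_comm, tsub_add_tsub_cancel htT.le hst.le] at h2
  have h3 := igMoment_pos (δ := c * T) (g := γ) (by positivity) hγ n
  have h4 := igPoly_pos (mul_pos hc (sub_pos.2 (NNReal.coe_lt_coe.2 (hst.trans htT)))) hγ n hx
  simp only [Set.indicator_univ, one_mul, Measure.restrict_univ] at h1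
  rw [← h2, levySemigroup_gigTilt hS hc hγ n (hst.trans htT) hx] at h1
  refine (ENNReal.mul_left_inj (c := ENNReal.ofReal _) ?_ ENNReal.ofReal_ne_top).1
    (h1.symm.trans (one_mul _).symm)
  rw [ne_eq, ENNReal.ofReal_eq_zero, not_le]
  positivity

end Semigroup

lemma currentSigma_le_naturalSigma {Ω : Type*} (ξ : ℝ≥0 → Ω → ℝ) (t : ℝ≥0) :
    currentSigma ξ t ≤ naturalSigma ξ t :=
  le_iSup₂_of_le (f := fun s (_ : s ∈ Set.Iic t) =>
    MeasurableSpace.comap (ξ s) inferInstance) t Set.self_mem_Iic le_rfl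

/-! ### Conditional laws of the bridge -/

section Bridge

variable {Ω Ω' : Type*} [MeasurableSpace Ω] [MeasurableSpace Ω'] {P : Measure Ω}
  [IsProbabilityMeasure P] {P' : Measure Ω'} [IsProbabilityMeasure P'] {c γ : ℝ} {T : ℝ≥0} {n : ℕ}
  {ξ : ℝ≥0 → Ω → ℝ} {S : ℝ≥0 → Ω' → ℝ}

lemma naturalSigma_le {t : ℝ≥0} (hξ : ∀ s ≤ t, Measurable (ξ s)) :
    naturalSigma ξ t ≤ ‹MeasurableSpace Ω› :=
  iSup₂_le fun s hs => (hξ s hs).comap_le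

/-- A stable-1/2 random bridge with generalized inverse-Gaussian terminal law is a terminal
transform of a stable-1/2 subordinator. -/
lemma IsStableHalfRandomBridge.exists_isTerminalTransform (hc : 0 < c) (hγ : 0 < γ) (hT : 0 < T)
    (hξ : IsStableHalfRandomBridge c T (gigMeasure ((n : ℝ) - 1 / 2) (c * T) γ) ξ P) :
    ∃ (Ω' : Type) (_ : MeasurableSpace Ω') (P' : Measure Ω') (_ : IsProbabilityMeasure P')
      (S : ℝ≥0 → Ω' → ℝ), IsStableHalfSubordinator c S P' ∧
        IsTerminalTransform T (gigTilt n (c * T) γ) ξ P S P' := by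
  obtain ⟨Ω', _, P', _, S, hS, hcond⟩ := hξ.bridge
  refine ⟨Ω', _, P', ‹_›, S, hS, isTerminalTransform_of_condDistrib hξ.measurable hS.measurable
    hξ.start hS.start (measurable_gigTilt _ _ _) ?_ ?_⟩
  · rw [hξ.terminal, gigMeasure_eq_withDensity (by positivity) hγ, hS.law T hT]
    rfl
  · rwa [hξ.terminal]

/-- Conditional expectations of functions of the terminal value that tilt the gamma factor. -/
lemma IsTerminalTransform.condExp_terminal (hS : IsStableHalfSubordinator c S P')
    (hTr : IsTerminalTransform T (gigTilt n (c * T) γ) ξ P S P')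
    (hξ : ∀ t ≤ T, Measurable (ξ t)) (hc : 0 < c) (hγ : 0 < γ) (hT : 0 < T)
    {f : ℝ → ℝ} (hf : Measurable f) (hf0 : ∀ y, 0 ≤ y → 0 ≤ f y) {N : ℕ} {g : ℝ} (hg : 0 < g)
    (hfg : ∀ y, 0 ≤ y → f y * (y ^ n * Real.exp (-(γ ^ 2 / 2) * y)) =
      y ^ N * Real.exp (-(g ^ 2 / 2) * y)) :
    Integrable (fun ω => f (ξ T ω)) P ∧ ∀ t < T, ∀ m : MeasurableSpace Ω,
      currentSigma ξ t ≤ m → m ≤ naturalSigma ξ t →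
      P[fun ω => f (ξ T ω) | m] =ᵐ[P] fun ω =>
        igPoly (c * (T - t)) g N (ξ t ω) / igPoly (c * (T - t)) γ n (ξ t ω) *
          Real.exp ((γ ^ 2 - g ^ 2) / 2 * ξ t ω - c * (T - t) * (g - γ)) := by
  have hsig : ∀ t ≤ T, naturalSigma ξ t ≤ ‹MeasurableSpace Ω› := fun t ht =>
    naturalSigma_le fun s hs => hξ s (hs.trans ht)
  have hfT : Measurable fun ω => f (ξ T ω) := hf.comp (hξ T le_rfl)
  have hh := measurable_gigTilt n (c * T) γ
  have hnn : ∀ t ≤ T, ∀ᵐ ω ∂P, 0 ≤ ξ t ω := fun t ht =>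
    hTr.ae_of_ae ht (hξ t ht) measurableSet_Ici (hS.ae_nonneg t)
  have hK : 0 < Real.exp (γ * (c * T)) / igMoment (c * T) γ n := by
    have := igMoment_pos (δ := c * T) (g := γ) (by positivity) hγ n
    positivity
  set K := Real.exp (γ * (c * T)) / igMoment (c * T) γ n with hKdef
  have hprod : ∀ y, 0 ≤ y → ENNReal.ofReal (f y) * gigTilt n (c * T) γ y =
      ENNReal.ofReal (K * (y ^ N * Real.exp (-(g ^ 2 / 2) * y))) := by
    intro y hy
    rw [gigTilt, ← hKdef, ← ENNReal.ofReal_mul (hf0 y hy), ← hfg y hy]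
    ring_nf
  have hfin : ∫⁻ ω, ENNReal.ofReal (f (ξ T ω)) ∂P ≠ ∞ := by
    have h1 := hTr {T} (by simp) (fun x => ENNReal.ofReal (f (x ⟨T, by simp⟩))) (by fun_prop)
    have h2 : ∫⁻ ω, ENNReal.ofReal (f (S T ω)) * gigTilt n (c * T) γ (S T ω) ∂P' =
        levySemigroup S P' T (fun y => ENNReal.ofReal (f y) * gigTilt n (c * T) γ y) 0 := by
      rw [levySemigroup, lintegral_map (by fun_prop) (hS.measurable T)]
      simp only [zero_add]
    rw [h1, h2, levySemigroup_congr hS hprod T le_rfl,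
      levySemigroup_pow_mul_exp hS hc hg hK.le N hT le_rfl]
    exact ENNReal.ofReal_ne_top
  have hX0 : 0 ≤ᵐ[P] fun ω => f (ξ T ω) := by
    filter_upwards [hnn T le_rfl] with ω hω using hf0 _ hω
  refine ⟨(lintegral_ofReal_ne_top_iff_integrable hfT.aestronglyMeasurable hX0).1 hfin,
    fun t ht => ?_⟩
  have htT : 0 < c * ((T : ℝ) - t) := mul_pos hc (sub_pos.2 (NNReal.coe_lt_coe.2 ht))
  let G : ℝ → ℝ := fun x => igPoly (c * (T - t)) g N x / igPoly (c * (T - t)) γ n x *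
    Real.exp ((γ ^ 2 - g ^ 2) / 2 * x - c * (T - t) * (g - γ))
  have hGm : Measurable G :=
    ((measurable_igPoly _ _ _).div (measurable_igPoly _ _ _)).mul (by fun_prop)
  have hG0 : ∀ x, 0 ≤ x → 0 ≤ G x := fun x hx => by
    have := igPoly_pos htT hg N hx
    have := igPoly_pos htT hγ n hx
    positivity
  have hkey : ∀ A, MeasurableSet[naturalSigma ξ t] A →
      ∫⁻ ω in A, ENNReal.ofReal (f (ξ T ω)) ∂P = ∫⁻ ω in A, ENNReal.ofReal (G (ξ t ω)) ∂P := by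
    intro A hA
    refine hTr.setLIntegral_eq (φ := fun y => ENNReal.ofReal (f y))
      (G := fun y => ENNReal.ofReal (G y)) hS.toIsLevyProcess hh hξ hS.ae_nonneg ht.le le_rfl
      hf.ennreal_ofReal hGm.ennreal_ofReal hfin (fun x hx => ?_) hA
    -- At the terminal time the remaining semigroup is the identity, so f is multiplied by h itself.
    have h1 : ∀ y, 0 ≤ y →
        ENNReal.ofReal (f y) * levySemigroup S P' (T - T) (gigTilt n (c * T) γ) y =
          ENNReal.ofReal (K * (y ^ N * Real.exp (-(g ^ 2 / 2) * y))) := by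
      intro y hy
      rw [tsub_self, levySemigroup_zero hS.start (hS.measurable 0) hh, hprod y hy]
    rw [levySemigroup_congr hS h1 _ hx,
      levySemigroup_pow_mul_exp hS hc hg hK.le N (tsub_pos_of_lt ht) hx,
      levySemigroup_gigTilt hS hc hγ n ht hx, ← hKdef, NNReal.coe_sub ht.le,
      ← ENNReal.ofReal_mul (hG0 x hx)]
    congr 1
    have h2 := (igPoly_pos htT hγ n hx).ne'
    have h3 : Real.exp (-(g ^ 2 / 2) * x - g * (c * (T - t))) =
        Real.exp ((γ ^ 2 - g ^ 2) / 2 * x - c * (T - t) * (g - γ)) *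
          Real.exp (-(γ ^ 2 / 2) * x - γ * (c * (T - t))) := by
      rw [← Real.exp_add]; congr 1; ring
    rw [h3]
    simp only [G]
    field_simp
  -- The answer is a function of ξ_t, so it is measurable for any σ-algebra between that of ξ_t and
  -- the whole past; both kinds of conditioning follow at once.
  intro m hm1 hm2
  refine condExp_ae_eq_of_setLIntegral_eq (Y := fun ω => G (ξ t ω)) (hm2.trans (hsig t ht.le))
    hfT (hGm.comp ((comap_measurable (ξ t)).mono hm1 le_rfl)) hX0 ?_ hfin
    fun A hA => hkey A (hm2 _ hA)
  filter_upwards [hnn t ht.le] with ω hω using hG0 _ hω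

/-- The Markov property of the bridge with the explicit transition density. -/
lemma IsTerminalTransform.setLIntegral_indicator (hS : IsStableHalfSubordinator c S P')
    (hTr : IsTerminalTransform T (gigTilt n (c * T) γ) ξ P S P')
    (hξ : ∀ t ≤ T, Measurable (ξ t)) (hc : 0 < c) (hγ : 0 < γ) {s t : ℝ≥0} (hst : s < t)
    (htT : t < T) {B : Set ℝ} (hB : MeasurableSet B) {A : Set Ω}
    (hA : MeasurableSet[naturalSigma ξ s] A) :
    ∫⁻ ω in A, B.indicator (fun _ => 1) (ξ t ω) ∂P =
      ∫⁻ ω in A, (∫⁻ y in B, ENNReal.ofReal (gigMixture n c γ T s t (ξ s ω) y)) ∂P := by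
  refine hTr.setLIntegral_eq (φ := B.indicator fun _ => 1)
    (G := fun x => ∫⁻ y in B, ENNReal.ofReal (gigMixture n c γ T s t x y)) hS.toIsLevyProcess
    (measurable_gigTilt _ _ _) hξ hS.ae_nonneg hst.le htT.le (measurable_const.indicator hB)
    (Measurable.lintegral_prod_right' (measurable_gigMixture n).ennreal_ofReal) ?_
    (fun x hx => levySemigroup_indicator_mul hS hc hγ n hst htT hB hx) hA
  refine ne_top_of_le_ne_top ENNReal.one_ne_top (le_trans (lintegral_mono (g := fun _ => 1) ?_)
    (by simp))
  intro ω
  exact Set.indicator_le_self' (fun _ _ => zero_le) (ξ t ω)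

/-- The integrated Markov property over events {ξ_s ∈ A} says that the joint law of (ξ_s, ξ_t)
disintegrates through the mixture kernel; uniqueness of disintegration concludes. -/
lemma IsTerminalTransform.condDistrib_eq (hS : IsStableHalfSubordinator c S P')
    (hTr : IsTerminalTransform T (gigTilt n (c * T) γ) ξ P S P')
    (hξ : ∀ t ≤ T, Measurable (ξ t)) (hc : 0 < c) (hγ : 0 < γ) {s t : ℝ≥0} (hst : s < t)
    (htT : t < T) :
    ∀ᵐ x ∂(P.map (ξ s)), condDistrib (ξ t) (ξ s) P x =
      volume.withDensity fun y => ENNReal.ofReal (gigMixture n c γ T s t x y) := by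
  have hsm := hξ s (hst.trans htT).le
  have htm := hξ t htT.le
  -- For x < 0 the mixture need not be a density; cutting it off there gives a finite kernel, and
  -- ξ_s ≥ 0 almost surely makes the change harmless.
  let p : ℝ → ℝ → ℝ≥0∞ := fun x y =>
    if 0 ≤ x then ENNReal.ofReal (gigMixture n c γ T s t x y) else 0
  have hp : Measurable (Function.uncurry p) :=
    Measurable.ite (measurableSet_Ici.preimage measurable_fst)
      (measurable_gigMixture n).ennreal_ofReal measurable_const
  let κ : Kernel ℝ ℝ := Kernel.withDensity (Kernel.const ℝ volume) p
  have hκ : ∀ x B, κ x B = ∫⁻ y in B, p x y := fun x B => by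
    simp only [κ]
    rw [Kernel.withDensity_apply' _ hp, Kernel.const_apply]
  have hpos : ∀ x, 0 ≤ x → p x = fun y => ENNReal.ofReal (gigMixture n c γ T s t x y) :=
    fun x hx => by ext y; simp [p, hx]
  have : IsFiniteKernel κ := ⟨1, ENNReal.one_lt_top, fun x => by
    rw [hκ, Measure.restrict_univ]
    by_cases hx : 0 ≤ x
    · rw [hpos x hx, lintegral_gigMixture hS hc hγ n hst htT hx]
    · simp [p, hx]⟩
  have hnn : ∀ᵐ ω ∂P, 0 ≤ ξ s ω :=
    hTr.ae_of_ae (hst.trans htT).le hsm measurableSet_Ici (hS.ae_nonneg s)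
  have hjoint : P.map (fun ω => (ξ s ω, ξ t ω)) = P.map (ξ s) ⊗ₘ κ := by
    refine Measure.ext_prod fun {A B} hA hB => ?_
    rw [Measure.map_apply (hsm.prodMk htm) (hA.prod hB), Measure.compProd_apply_prod hA hB,
      setLIntegral_map hA (κ.measurable_coe hB) hsm]
    have hA' : MeasurableSet[naturalSigma ξ s] (ξ s ⁻¹' A) :=
      currentSigma_le_naturalSigma ξ s _ ⟨A, hA, rfl⟩
    have h1 := hTr.setLIntegral_indicator hS hξ hc hγ hst htT hB hA'
    have h2 : ∫⁻ ω in ξ s ⁻¹' A, κ (ξ s ω) B ∂P = ∫⁻ ω in ξ s ⁻¹' A,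
        (∫⁻ y in B, ENNReal.ofReal (gigMixture n c γ T s t (ξ s ω) y)) ∂P := by
      refine lintegral_congr_ae (ae_restrict_of_ae ?_)
      filter_upwards [hnn] with ω hω
      rw [hκ, hpos _ hω]
    have h3 : (fun ω => B.indicator (fun _ => (1 : ℝ≥0∞)) (ξ t ω)) =
        (ξ t ⁻¹' B).indicator fun _ => 1 := rfl
    rw [h2, ← h1, h3, lintegral_indicator_const (htm hB), one_mul,
      Measure.restrict_apply (htm hB), Set.inter_comm]
    rfl
  have hnn' : ∀ᵐ x ∂(P.map (ξ s)), x ∈ Set.Ici (0 : ℝ) :=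
    (ae_map_iff hsm.aemeasurable measurableSet_Ici).2 hnn
  filter_upwards [condDistrib_ae_eq_of_measure_eq_compProd (ξ s) htm.aemeasurable hjoint, hnn']
    with x hx hx0
  rw [hx]
  simp only [κ]
  rw [Kernel.withDensity_apply _ hp, Kernel.const_apply, hpos x hx0]

lemma IsTerminalTransform.condExp_indicator (hS : IsStableHalfSubordinator c S P')
    (hTr : IsTerminalTransform T (gigTilt n (c * T) γ) ξ P S P')
    (hξ : ∀ t ≤ T, Measurable (ξ t)) (hc : 0 < c) (hγ : 0 < γ) {s t : ℝ≥0} (hst : s < t)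
    (htT : t < T) {B : Set ℝ} (hB : MeasurableSet B) :
    P[(ξ t ⁻¹' B).indicator (fun _ => (1 : ℝ)) | naturalSigma ξ s] =ᵐ[P] fun ω =>
      ∫ y in B, gigMixture n c γ T s t (ξ s ω) y := by
  have hst' : (s : ℝ) < t := NNReal.coe_lt_coe.2 hst
  have htT' : (t : ℝ) < T := NNReal.coe_lt_coe.2 htT
  have hsm := hξ s (hst.trans htT).le
  have htm := hξ t htT.le
  have hnn : ∀ᵐ ω ∂P, 0 ≤ ξ s ω :=
    hTr.ae_of_ae (hst.trans htT).le hsm measurableSet_Ici (hS.ae_nonneg s)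
  have hmix : ∀ x, Measurable fun y => gigMixture n c γ T s t x y :=
    measurable_gigMixture_right n
  have hmix0 : ∀ x, 0 ≤ x → 0 ≤ fun y => gigMixture n c γ T s t x y := fun x hx y =>
    gigMixture_nonneg hc hγ hst' htT' n hx y
  have hmixi : ∀ x, 0 ≤ x → Integrable fun y => gigMixture n c γ T s t x y := fun x hx => by
    refine (lintegral_ofReal_ne_top_iff_integrable (hmix x).aestronglyMeasurable
      (Eventually.of_forall (hmix0 x hx))).1 ?_
    rw [lintegral_gigMixture hS hc hγ n hst htT hx]
    exact ENNReal.one_ne_top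
  have hG : Measurable fun x => ∫ y in B, gigMixture n c γ T s t x y :=
    (measurable_gigMixture n).stronglyMeasurable.integral_prod_right.measurable
  have hle : naturalSigma ξ s ≤ ‹MeasurableSpace Ω› :=
    naturalSigma_le fun r hr => hξ r (hr.trans (hst.trans htT).le)
  have hind : ∀ ω, ENNReal.ofReal ((ξ t ⁻¹' B).indicator (fun _ => (1 : ℝ)) ω) =
      B.indicator (fun _ => 1) (ξ t ω) := by
    intro ω
    by_cases h : ξ t ω ∈ B <;> simp [h]
  refine condExp_ae_eq_of_setLIntegral_eq hle (measurable_const.indicator (htm hB))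
    (hG.comp ((comap_measurable (ξ s)).mono (currentSigma_le_naturalSigma ξ s) le_rfl)) ?_ ?_ ?_
    fun A hA => ?_
  · exact Eventually.of_forall fun ω => Set.indicator_nonneg (fun _ _ => zero_le_one) ω
  · filter_upwards [hnn] with ω hω
    exact integral_nonneg (hmix0 _ hω)
  · refine ne_top_of_le_ne_top ENNReal.one_ne_top
      (le_trans (lintegral_mono (g := fun _ => 1) fun ω => ?_) (by simp))
    rw [hind]
    exact Set.indicator_le_self' (fun _ _ => zero_le) (ξ t ω)
  · simp_rw [hind]
    rw [hTr.setLIntegral_indicator hS hξ hc hγ hst htT hB hA]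
    refine lintegral_congr_ae (ae_restrict_of_ae ?_)
    filter_upwards [hnn] with ω hω
    rw [ofReal_integral_eq_lintegral_ofReal (hmixi _ hω).integrableOn
      (Eventually.of_forall (hmix0 _ hω))]

end Bridge

/-! ### The main theorem -/

theorem mainTheorem2 {Ω : Type*} [MeasurableSpace Ω] (P : Measure Ω) [IsProbabilityMeasure P]
    (c γ : ℝ) (hc : 0 < c) (hγ : 0 < γ) (T : ℝ≥0) (hT : 0 < T) (n : ℕ) (hn : 1 ≤ n)
    (ξ : ℝ≥0 → Ω → ℝ)
    (hξ : IsStableHalfRandomBridge c T (gigMeasure ((n : ℝ) - 1 / 2) (c * T) γ) ξ P) :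
    -- the inverse-Gaussian moments are finite, and the denominators below do not vanish
    (∀ δ g : ℝ, 0 < δ → 0 < g → ∀ k : ℕ, Integrable (fun x => x ^ k * igPDF δ g x)) ∧
    (∀ t < T, (∀ᵐ ω ∂P, 0 ≤ ξ t ω) ∧ ∀ x : ℝ, 0 ≤ x → 0 < igPoly (c * (T - t)) γ n x) ∧
    -- best estimate of the ultimate loss
    (Integrable (ξ T) P ∧ ∀ t < T,
      P[ξ T | naturalSigma ξ t] =ᵐ[P] (fun ω =>
        igPoly (c * (T - t)) γ (n + 1) (ξ t ω) / igPoly (c * (T - t)) γ n (ξ t ω)) ∧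
      P[ξ T | currentSigma ξ t] =ᵐ[P] (fun ω =>
        igPoly (c * (T - t)) γ (n + 1) (ξ t ω) / igPoly (c * (T - t)) γ n (ξ t ω))) ∧
    -- higher moments
    (∀ m : ℕ, 1 ≤ m → Integrable (fun ω => ξ T ω ^ m) P ∧ ∀ t < T,
      P[fun ω => ξ T ω ^ m | currentSigma ξ t] =ᵐ[P] fun ω =>
        igPoly (c * (T - t)) γ (n + m) (ξ t ω) / igPoly (c * (T - t)) γ n (ξ t ω)) ∧
    -- exponential moments
    (∀ a : ℝ, 0 < a → a < γ →
      Integrable (fun ω => Real.exp (1 / 2 * a ^ 2 * ξ T ω)) P ∧ ∀ t < T,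
      P[fun ω => Real.exp (1 / 2 * a ^ 2 * ξ T ω) | currentSigma ξ t] =ᵐ[P] fun ω =>
        igPoly (c * (T - t)) (Real.sqrt (γ ^ 2 - a ^ 2)) n (ξ t ω) /
            igPoly (c * (T - t)) γ n (ξ t ω) *
          Real.exp (1 / 2 * a ^ 2 * ξ t ω -
            c * (T - t) * (Real.sqrt (γ ^ 2 - a ^ 2) - γ))) ∧
    -- transition density: law of `ξ_t` given `ξ_s = x`, and given the past up to time `s`
    (∀ s t : ℝ≥0, s < t → t < T →
      (∀ᵐ x ∂(P.map (ξ s)), condDistrib (ξ t) (ξ s) P x =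
        volume.withDensity fun y => ENNReal.ofReal (gigMixture n c γ T s t x y)) ∧
      (∀ B : Set ℝ, MeasurableSet B →
        P[(ξ t ⁻¹' B).indicator (fun _ => (1 : ℝ)) | naturalSigma ξ s] =ᵐ[P] fun ω =>
          ∫ y in B, gigMixture n c γ T s t (ξ s ω) y) ∧
      -- the weights of the mixture
      (∀ x : ℝ, 0 ≤ x → (∀ k ≤ n, 0 ≤ gigWeight n c γ T s t k x) ∧
        ∑ k ∈ Finset.range (n + 1), gigWeight n c γ T s t k x = 1)) := by
  obtain ⟨Ω', _, P', _, S, hS, hTr⟩ := hξ.exists_isTerminalTransform hc hγ hT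
  have hm := hξ.measurable
  have hmoment : ∀ m : ℕ, Integrable (fun ω => ξ T ω ^ m) P ∧ ∀ t < T, ∀ 𝓕 : MeasurableSpace Ω,
      currentSigma ξ t ≤ 𝓕 → 𝓕 ≤ naturalSigma ξ t →
      P[fun ω => ξ T ω ^ m | 𝓕] =ᵐ[P] fun ω =>
        igPoly (c * (T - t)) γ (n + m) (ξ t ω) / igPoly (c * (T - t)) γ n (ξ t ω) := by
    intro m
    -- With g = γ the exponential factor is 1, and y^m only raises the degree from n to n + m.
    have h := hTr.condExp_terminal hS hm hc hγ hT (f := fun y => y ^ m) (by fun_prop)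
      (fun y hy => by positivity) (N := n + m) hγ (fun y _ => by ring)
    simpa using h
  refine ⟨fun δ g hδ hg k => integrable_pow_mul_igPDF hδ hg k, fun t ht => ⟨?_, fun x hx => ?_⟩,
    ⟨?_, fun t ht => ⟨?_, ?_⟩⟩, fun m _ => ⟨(hmoment m).1, fun t ht => ?_⟩, fun a ha haγ => ?_,
    fun s t hst htT => ⟨?_, fun B hB => ?_, fun x hx => ⟨fun k _ => ?_, ?_⟩⟩⟩
  · exact hTr.ae_of_ae ht.le (hm t ht.le) measurableSet_Ici (hS.ae_nonneg t)
  · exact igPoly_pos (mul_pos hc (sub_pos.2 (NNReal.coe_lt_coe.2 ht))) hγ n hx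
  · simpa using (hmoment 1).1
  · simpa using (hmoment 1).2 t ht _ (currentSigma_le_naturalSigma ξ t) le_rfl
  · simpa using (hmoment 1).2 t ht _ le_rfl (currentSigma_le_naturalSigma ξ t)
  · exact (hmoment m).2 t ht _ le_rfl (currentSigma_le_naturalSigma ξ t)
  · have hpos : 0 < γ ^ 2 - a ^ 2 := by nlinarith
    have hsq : Real.sqrt (γ ^ 2 - a ^ 2) ^ 2 = γ ^ 2 - a ^ 2 := Real.sq_sqrt hpos.le
    -- Here the degree stays n, and g = √(γ² - a²) absorbs the exponential into the Gaussian-type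
    -- tilt: a²/2 - γ²/2 = -g²/2.
    obtain ⟨h1, h2⟩ := hTr.condExp_terminal hS hm hc hγ hT
      (f := fun y => Real.exp (1 / 2 * a ^ 2 * y)) (by fun_prop) (fun y _ => (Real.exp_pos _).le)
      (N := n) (Real.sqrt_pos.2 hpos) (fun y _ => by
        rw [hsq, mul_left_comm, ← Real.exp_add]; ring_nf)
    refine ⟨h1, fun t ht => ?_⟩
    have h3 := h2 t ht _ le_rfl (currentSigma_le_naturalSigma ξ t)
    have h4 : (γ ^ 2 - Real.sqrt (γ ^ 2 - a ^ 2) ^ 2) / 2 = 1 / 2 * a ^ 2 := by rw [hsq]; ring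
    rwa [h4] at h3
  · exact hTr.condDistrib_eq hS hm hc hγ hst htT
  · exact hTr.condExp_indicator hS hm hc hγ hst htT hB
  · exact gigWeight_nonneg hc hγ n (NNReal.coe_lt_coe.2 hst) (NNReal.coe_lt_coe.2 htT) hx k
  · exact sum_gigWeight hS hc hγ n hst htT hx
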